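/- **Theorem (Induced subgraph games).** The class of induced subgraph games is efficiently (properly) PAC learnable, by a consistent learning algorithm. Here an *induced subgraph game* on $N=\{1,\dots,n\}$ is given by an undirected graph on $N$ with integer edge weights $w_{ij}=w_{ji}\in\mathbb Z$, $w_{ii}=0$; the value of a coalition $S\subseteq N$ is the total weight of the subgraph it induces, $$v(S)=\sum_{i\in S}\ \sum_{j\in S,\ j>i} w_{ij}.$$ Explicitly: there are a deterministic algorithm $\mathcal A$, a function $m_0(n,\varepsilon,\delta)$ that is bounded by a polynomial in $n$, $\frac1\varepsilon$ and $\frac1\delta$, and a polynomial $p$ such that for all $n\in\mathbb N$, all induced subgraph games $v$ on $N$ and all real $\varepsilon,\delta>0$ the following hold. 1. (Running time.) For every $m\ge 0$ and all coalitions $S_1,\dots,S_m\subseteq N$, given $n$, $\lceil 1/\varepsilon\rceil$, $\lceil 1/\delta\rceil$, $m$ and the labelled samples $(S_1,v(S_1)),\dots,(S_m,v(S_m))$, the algorithm $\mathcal A$ halts and outputs the weight matrix of an induced subgraph game $v^*$ on $N$, in time at most $p\bigl(n+\lceil 1/\varepsilon\rceil+\lceil 1/\delta\rceil+\ell\bigr)$,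 where $\ell$ is the bit length of the input. Time is the logarithmic cost on a random access machine with integer arithmetic: each elementary operation costs one plus the bit lengths of the integers it handles. 2. (Consistency.) For these inputs, $v^*(S_j)=v(S_j)$ for all $j=1,\dots,m$. 3. (PAC guarantee.) For every probability distribution $\mathcal D$ on $2^N$ and every $m\ge m_0(n,\varepsilon,\delta)$, if $S_1,\dots,S_m$ are drawn independently from $\mathcal D$, then with probability at least $1-\delta$ over the samples, $$\Pr_{S\sim\mathcal D}\bigl[v(S)\ne v^*(S)\bigr]<\varepsilon .$$ -/

import Mathlib

/-! ### A random access machine with logarithmic cost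

Programs are finite syntax trees of a structured imperative language over integer variables and
integer arrays. Every elementary operation is charged one unit plus the bit lengths of the integers
it handles (operands, constants, array addresses, array contents): the logarithmic cost criterion.
Hence all values produced within cost `t` have bit length `O(t)`, and "polynomial cost" means the
same as "polynomial time on a Turing machine". -/

namespace RAM

/-- Bit length of an integer. -/
def bits (z : ℤ) : ℕ := Nat.size z.natAbs

/-- Memory: integer variables, and integer arrays addressed by integers. A program
mentions only finitely many variables and arrays. -/
structure State where
  var : ℕ → ℤ
  arr : ℕ → ℤ → ℤ

/-- Binary arithmetic instructions. -/
inductive Op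
  | add | sub | mul | div | mod

/-- Meaning of the arithmetic instructions (`div`, `mod` are Euclidean division with remainder). -/
def Op.eval : Op → ℤ → ℤ → ℤ
  | .add, x, y => x + y
  | .sub, x, y => x - y
  | .mul, x, y => x * y
  | .div, x, y => x / y
  | .mod, x, y => x % y

/-- Arithmetic expressions; `read a e` is the content of array `a` at the address `e`. -/
inductive Expr
  | const (z : ℤ)
  | var (x : ℕ)
  | read (a : ℕ) (e : Expr)
  | bin (o : Op) (e₁ e₂ : Expr)

/-- Value of an expression. -/
def Expr.eval (s : State) : Expr → ℤ
  | .const z => z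
  | .var x => s.var x
  | .read a e => s.arr a (e.eval s)
  | .bin o e₁ e₂ => o.eval (e₁.eval s) (e₂.eval s)

/-- Logarithmic cost of evaluating an expression. -/
def Expr.cost (s : State) : Expr → ℕ
  | .const z => 1 + bits z
  | .var x => 1 + bits (s.var x)
  | .read a e => e.cost s + 1 + bits (e.eval s) + bits (s.arr a (e.eval s))
  | .bin _ e₁ e₂ => e₁.cost s + e₂.cost s + 1 + bits (e₁.eval s) + bits (e₂.eval s)

/-- Programs. The tests of `ite` and `while` succeed iff the value of the expression is positive. -/
inductive Program
  | skip
  | assign (x : ℕ) (e : Expr)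
  | write (a : ℕ) (idx e : Expr)
  | seq (c₁ c₂ : Program)
  | ite (e : Expr) (c₁ c₂ : Program)
  | while (e : Expr) (c : Program)

/-- The state after storing `z` in the variable `x`. -/
def State.setVar (s : State) (x : ℕ) (z : ℤ) : State :=
  { s with var := Function.update s.var x z }

/-- The state after storing `z` in array `a` at the address `i`. -/
def State.setArr (s : State) (a : ℕ) (i z : ℤ) : State :=
  { s with arr := Function.update s.arr a (Function.update (s.arr a) i z) }

/-- `Exec c s t s'`: the program `c`, started in state `s`, halts in state `s'` at total
cost `t`. -/
inductive Exec : Program → State → ℕ → State → Prop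
  | skip (s : State) : Exec .skip s 1 s
  | assign (x : ℕ) (e : Expr) (s : State) :
      Exec (.assign x e) s (1 + e.cost s) (s.setVar x (e.eval s))
  | write (a : ℕ) (idx e : Expr) (s : State) :
      Exec (.write a idx e) s (1 + idx.cost s + e.cost s) (s.setArr a (idx.eval s) (e.eval s))
  | seq {c₁ c₂ : Program} {s s₁ s₂ : State} {t₁ t₂ : ℕ} :
      Exec c₁ s t₁ s₁ → Exec c₂ s₁ t₂ s₂ → Exec (.seq c₁ c₂) s (t₁ + t₂) s₂
  | ite_pos {e : Expr} {c₁ c₂ : Program} {s s' : State} {t : ℕ} :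
      0 < e.eval s → Exec c₁ s t s' → Exec (.ite e c₁ c₂) s (1 + e.cost s + t) s'
  | ite_neg {e : Expr} {c₁ c₂ : Program} {s s' : State} {t : ℕ} :
      ¬ 0 < e.eval s → Exec c₂ s t s' → Exec (.ite e c₁ c₂) s (1 + e.cost s + t) s'
  | while_pos {e : Expr} {c : Program} {s s₁ s₂ : State} {t₁ t₂ : ℕ} :
      0 < e.eval s → Exec c s t₁ s₁ → Exec (.while e c) s₁ t₂ s₂ →
      Exec (.while e c) s (1 + e.cost s + t₁ + t₂) s₂
  | while_neg {e : Expr} {c : Program} {s : State} :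
      ¬ 0 < e.eval s → Exec (.while e c) s (1 + e.cost s) s

/-- Initial state on the input list `l`: array `0` holds the length of `l` at the address `0` and
the entries of `l` at the addresses `1, 2, …`; everything else is `0`. -/
def State.init (l : List ℤ) : State where
  var _ := 0
  arr a i :=
    if a = 0 then
      if i = 0 then (l.length : ℤ) else if 0 < i then l.getD (i - 1).toNat 0 else 0
    else 0

/-- The state holds the output list `l`: array `1` contains the length of `l` at the address `0`
and the entries of `l` at the addresses `1, 2, …`. -/
def State.HoldsOutput (s : State) (l : List ℤ) : Prop :=
  s.arr 1 0 = (l.length : ℤ) ∧ ∀ i : Fin l.length, s.arr 1 ((i : ℤ) + 1) = l.get i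

/-- On the input list `input` the program halts at cost `t` with output list `output`. -/
def Program.Computes (c : Program) (input output : List ℤ) (t : ℕ) : Prop :=
  ∃ s : State, Exec c (State.init input) t s ∧ s.HoldsOutput output

/-- Number of bits of an input list (one more for each entry, as a separator). -/
def inputSize (l : List ℤ) : ℕ := (l.map fun z => 1 + bits z).sum

end RAM

/-! ### PAC learning of classes of cooperative games -/

namespace PAC

open scoped Classical in
/-- Probability of the event `E` under the distribution `D` on a finite type. -/
noncomputable def prob {α : Type} [Fintype α] (D : PMF α) (E : α → Prop) : ℝ :=
  ∑ a : α, if E a then (D a).toReal else 0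

open scoped Classical in
/-- Probability of the event `E` for `m` independent samples from `D`. -/
noncomputable def iidProb {α : Type} [Fintype α] (D : PMF α) (m : ℕ)
    (E : (Fin m → α) → Prop) : ℝ :=
  ∑ x : Fin m → α, if E x then ∏ i, (D (x i)).toReal else 0

/-- A class of integer-valued characteristic functions `v : 2^N → ℤ`, `N = {1, …, n}`, for each
number `n` of players. The members are given by representations, each of which is written
unambiguously as a list of integers. The class itself is the range of `value n`. -/
structure GameClass where
  /-- the representations of `n`-player games of the class -/
  Rep : ℕ → Type
  /-- the game that is represented -/
  value : ∀ n : ℕ, Rep n → Finset (Fin n) → ℤ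
  /-- how a representation is written down -/
  encode : ∀ n : ℕ, Rep n → List ℤ
  encode_injective : ∀ n : ℕ, Function.Injective (encode n)

/-- A labelled sample `(S, v(S))`: the indicator vector of `S`, followed by the value. -/
def encodeSample {n : ℕ} (v : Finset (Fin n) → ℤ) (S : Finset (Fin n)) : List ℤ :=
  (List.ofFn fun i : Fin n => if i ∈ S then (1 : ℤ) else 0) ++ [v S]

/-- The input of a learning algorithm: `n`, `⌈1/ε⌉`, `⌈1/δ⌉`, `m` and the labelled samples
`(S₁, v(S₁)), …, (S_m, v(S_m))`. -/
noncomputable def learnerInput {n : ℕ} (v : Finset (Fin n) → ℤ) (ε δ : ℝ) {m : ℕ}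
    (x : Fin m → Finset (Fin n)) : List ℤ :=
  [(n : ℤ), (⌈1 / ε⌉₊ : ℤ), (⌈1 / δ⌉₊ : ℤ), (m : ℤ)] ++
    (List.ofFn x).flatMap (encodeSample v)

/-- On every list of samples of a game of the class, `L` halts and outputs (a representation of) a
game of the class, in time polynomial in `n`, `1/ε`, `1/δ` and the bit length of the input. -/
def RunsInPolyTime (C : GameClass) (L : RAM.Program) : Prop :=
  ∃ p : Polynomial ℕ, ∀ (n : ℕ) (f : C.Rep n) (ε δ : ℝ), 0 < ε → 0 < δ →
    ∀ (m : ℕ) (x : Fin m → Finset (Fin n)), ∃ (h : C.Rep n) (t : ℕ),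
      L.Computes (learnerInput (C.value n f) ε δ x) (C.encode n h) t ∧
      t ≤ p.eval (n + ⌈1 / ε⌉₊ + ⌈1 / δ⌉₊ + RAM.inputSize (learnerInput (C.value n f) ε δ x))

/-- `L` properly PAC learns the class, with sample complexity `m₀`: given at least `m₀ n ε δ`
independent samples of a game `f` of the class from an arbitrary distribution `D` on coalitions, it
outputs with probability at least `1 - δ` a game `h` of the class with
`Pr_{S ∼ D}[f(S) ≠ h(S)] < ε`. -/
def PACLearns (C : GameClass) (L : RAM.Program) (m₀ : ℕ → ℝ → ℝ → ℕ) : Prop :=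
  ∀ (n : ℕ) (f : C.Rep n) (ε δ : ℝ), 0 < ε → 0 < δ →
    ∀ (D : PMF (Finset (Fin n))) (m : ℕ), m₀ n ε δ ≤ m →
      1 - δ ≤ iidProb D m fun x => ∃ (h : C.Rep n) (t : ℕ),
        L.Computes (learnerInput (C.value n f) ε δ x) (C.encode n h) t ∧
        prob D (fun S => C.value n f S ≠ C.value n h S) < ε

/-- `m₀` is bounded by a polynomial in `n`, `1/ε` and `1/δ`. -/
def PolynomiallyBounded (m₀ : ℕ → ℝ → ℝ → ℕ) : Prop :=
  ∃ P : MvPolynomial (Fin 3) ℝ, ∀ (n : ℕ) (ε δ : ℝ), 0 < ε → 0 < δ →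
    (m₀ n ε δ : ℝ) ≤ MvPolynomial.eval ![(n : ℝ), 1 / ε, 1 / δ] P

/-- `L` witnesses that the class is efficiently PAC learnable: it runs in polynomial time and
properly PAC learns the class with polynomial sample complexity. -/
def IsEfficientPACLearner (C : GameClass) (L : RAM.Program) : Prop :=
  RunsInPolyTime C L ∧ ∃ m₀ : ℕ → ℝ → ℝ → ℕ, PolynomiallyBounded m₀ ∧ PACLearns C L m₀

/-- On every list of samples of a game `f` of the class, `L` outputs a game of the class that agrees
with all the samples. -/
def IsConsistentLearner (C : GameClass) (L : RAM.Program) : Prop :=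
  ∀ (n : ℕ) (f : C.Rep n) (ε δ : ℝ), 0 < ε → 0 < δ →
    ∀ (m : ℕ) (x : Fin m → Finset (Fin n)), ∃ (h : C.Rep n) (t : ℕ),
      L.Computes (learnerInput (C.value n f) ε δ x) (C.encode n h) t ∧
      ∀ j : Fin m, C.value n h (x j) = C.value n f (x j)

end PAC

/-! ### Induced subgraph games -/

/-- Weighted adjacency matrices, with integer weights, of undirected graphs on `n` nodes. -/
def WeightedGraph (n : ℕ) : Type :=
  {W : Matrix (Fin n) (Fin n) ℤ // W.IsSymm ∧ ∀ i, W i i = 0}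

/-- The value of a coalition is the total weight of the subgraph that it induces. -/
def WeightedGraph.inducedValue {n : ℕ} (G : WeightedGraph n) (S : Finset (Fin n)) : ℤ :=
  ∑ i ∈ S, ∑ j ∈ S with i < j, G.1 i j

/-- The weight matrix, row by row. -/
def WeightedGraph.toList {n : ℕ} (G : WeightedGraph n) : List ℤ :=
  List.ofFn fun k : Fin (n * n) => G.1 k.divNat k.modNat

theorem WeightedGraph.toList_injective (n : ℕ) :
    Function.Injective (WeightedGraph.toList : WeightedGraph n → List ℤ) := by
  intro G H h
  have h' := List.ofFn_injective h
  apply Subtype.ext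
  ext i j
  have := congrFun h' (finProdFinEquiv (i, j))
  have e := finProdFinEquiv.symm_apply_apply (i, j)
  simp only [finProdFinEquiv_symm_apply, Prod.mk.injEq] at e
  simpa only [e.1, e.2] using this

/-- The class of induced subgraph games. -/
def inducedSubgraphGames : PAC.GameClass where
  Rep := WeightedGraph
  value _ G := G.inducedValue
  encode _ G := G.toList
  encode_injective := WeightedGraph.toList_injective

/-! ### Verifying programs of the random access machine -/

namespace RAM

/-! The value of a coalition is linear in the weights. A sample is therefore an integral linear
equation, with coefficients 0 and 1, for the d = n² entries of the weight matrix, and the hidden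
graph shows that the system of all samples is solvable over ℤ. Any integral solution is a consistent
hypothesis. It remains to find one in polynomial time and to bound the error of consistent
hypotheses.

Elimination by column operations, applied to the equations stacked on an identity matrix, describes
rational solutions as (f + ∑ t_j g_j) / D with integral f, g_j and D. By Sylvester's identity
(`minor_snoc_snoc`) every division is exact and every entry is a minor of the original matrix, so
bit lengths stay polynomial (`IsBordered.bounds`). Integrality of such a solution is a system of d
congruences modulo |D| for t. It is solvable, because t = w reproduces the hidden solution w
(`Invariant.solution_eq`). Euclid's algorithm on columns solves it row by row, and reduction modulo
|D| keeps the entries small (`Inner.euclid`, `Inner.reduce`). The resulting t gives an integral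
solution (`Invariant.isSolution`).

For the running time, all integers in memory are kept within L bits. A fixed expression then costs a
constant times L + 1, so only steps have to be counted (`Runs`).

For the error, let φ(S) be the indicator vector of the pairs inside S. A consistent hypothesis can
be wrong at S only if φ(S) lies outside the span of the sampled vectors. Among m + 1 vectors at most
d lie outside the span of the others. By exchangeability a fresh draw is outside with mean
probability at most d / (m + 1) (`expectation_notMem_span_le`), and Markov's inequality gives the
sample bound ⌈n² / (ε δ)⌉. -/

theorem bits_le_iff {z : ℤ} {L : ℕ} : bits z ≤ L ↔ z.natAbs < 2 ^ L := Nat.size_le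

theorem bits_mono {x y : ℤ} (h : x.natAbs ≤ y.natAbs) : bits x ≤ bits y := Nat.size_le_size h

theorem bits_add_le (x y : ℤ) : bits (x + y) ≤ bits x + bits y + 1 := by
  rw [bits_le_iff]
  have hx : x.natAbs < 2 ^ bits x := bits_le_iff.1 le_rfl
  have hy : y.natAbs < 2 ^ bits y := bits_le_iff.1 le_rfl
  have h1 : 2 ^ bits x ≤ 2 ^ (bits x + bits y) := Nat.pow_le_pow_right (by norm_num) (by omega)
  have h2 : 2 ^ bits y ≤ 2 ^ (bits x + bits y) := Nat.pow_le_pow_right (by norm_num) (by omega)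
  rw [pow_succ]
  omega

theorem bits_neg (x : ℤ) : bits (-x) = bits x := by simp [bits]

theorem bits_mul_le (x y : ℤ) : bits (x * y) ≤ bits x + bits y := by
  rw [bits_le_iff, Int.natAbs_mul, pow_add]
  have hx : x.natAbs < 2 ^ bits x := bits_le_iff.1 le_rfl
  have hy : y.natAbs < 2 ^ bits y := bits_le_iff.1 le_rfl
  exact Nat.mul_lt_mul'' hx hy

theorem Op.bits_eval_le (o : Op) (x y : ℤ) : bits (o.eval x y) ≤ bits x + bits y + 1 := by
  cases o with
  | add => exact bits_add_le x y
  | sub =>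
    have := bits_add_le x (-y)
    rwa [bits_neg, ← sub_eq_add_neg] at this
  | mul => exact (bits_mul_le x y).trans (Nat.le_succ _)
  | div =>
    have : bits (x / y) ≤ bits x := bits_mono (Int.natAbs_ediv_le_natAbs x y)
    simp only [Op.eval]
    omega
  | mod =>
    simp only [Op.eval]
    rcases eq_or_ne y 0 with rfl | hy
    · rw [Int.emod_zero]; omega
    · have : bits (x % y) ≤ bits y := by
        apply bits_mono
        have h1 := Int.emod_nonneg x hy
        have h2 := Int.emod_lt_abs x hy
        rw [Int.abs_eq_natAbs] at h2
        omega
      omega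

/-- Every integer in the memory has at most `L` bits. -/
def State.Bounded (s : State) (L : ℕ) : Prop :=
  (∀ x, bits (s.var x) ≤ L) ∧ ∀ a i, bits (s.arr a i) ≤ L

/-- Size of an expression; it governs the size of its value. -/
def Expr.size : Expr → ℕ
  | .const z => 1 + bits z
  | .var _ => 1
  | .read _ _ => 1
  | .bin _ e₁ e₂ => e₁.size + e₂.size + 1

/-- Weight of an expression; it governs the cost of its evaluation. -/
def Expr.wt : Expr → ℕ
  | .const z => 1 + bits z
  | .var _ => 1
  | .read _ e => e.wt + e.size + 1
  | .bin _ e₁ e₂ => e₁.wt + e₂.wt + e₁.size + e₂.size + 1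

/-- An operation at most adds the bit lengths and one more, so a fixed expression enlarges L + 1 by
a constant factor. A read counts as 1 whatever its address, since memory contents have at most L
bits. -/
theorem Expr.bits_eval_le {s : State} {L : ℕ} (h : s.Bounded L) (e : Expr) :
    bits (e.eval s) ≤ e.size * (L + 1) := by
  induction e with
  | const z => simp only [eval, size]; nlinarith [Nat.zero_le (bits z * L)]
  | var x => simp only [eval, size]; linarith [h.1 x]
  | read a e => simp only [eval, size]; linarith [h.2 a (e.eval s)]
  | bin o e₁ e₂ h₁ h₂ =>
    simp only [eval, size]
    refine (o.bits_eval_le _ _).trans ?_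
    rw [add_mul, add_mul]
    omega

theorem Expr.cost_le {s : State} {L : ℕ} (h : s.Bounded L) (e : Expr) :
    e.cost s ≤ e.wt * (L + 1) := by
  induction e with
  | const z => simp only [cost, wt]; nlinarith [Nat.zero_le (bits z * L)]
  | var x => simp only [cost, wt]; linarith [h.1 x]
  | read a e ih =>
    simp only [cost, wt]
    have h1 := h.2 a (e.eval s)
    have h2 := e.bits_eval_le h
    rw [add_mul, add_mul]
    omega
  | bin o e₁ e₂ h₁ h₂ =>
    simp only [cost, wt]
    have h3 := e₁.bits_eval_le h
    have h4 := e₂.bits_eval_le h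
    rw [add_mul, add_mul, add_mul, add_mul]
    omega

/-- Started in `s`, the program `c` halts within cost `T * (L + 1)` in a state satisfying `Q`. -/
def Runs (L : ℕ) (c : Program) (s : State) (T : ℕ) (Q : State → Prop) : Prop :=
  ∃ t s', Exec c s t s' ∧ t ≤ T * (L + 1) ∧ Q s'

/-! ### Rules for correctness and running time -/

variable {L T T₁ T₂ : ℕ} {s : State} {Q Q' : State → Prop} {c c₁ c₂ : Program}

theorem Runs.mono (h : Runs L c s T₁ Q) (hT : T₁ ≤ T) (hQ : ∀ s', Q s' → Q' s') :
    Runs L c s T Q' := by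
  obtain ⟨t, s', h1, h2, h3⟩ := h
  exact ⟨t, s', h1, h2.trans (Nat.mul_le_mul_right _ hT), hQ _ h3⟩

theorem Runs.imp (h : Runs L c s T Q) (hQ : ∀ s', Q s' → Q' s') : Runs L c s T Q' :=
  h.mono le_rfl hQ

theorem Runs.skip (h : Q s) : Runs L .skip s 1 Q := ⟨1, s, .skip s, by omega, h⟩

theorem Runs.assign {x : ℕ} {e : Expr} (hs : s.Bounded L) (h : Q (s.setVar x (e.eval s))) :
    Runs L (.assign x e) s (e.wt + 1) Q := by
  refine ⟨_, _, .assign x e s, ?_, h⟩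
  have := e.cost_le hs
  rw [add_mul]
  omega

theorem Runs.write {a : ℕ} {i e : Expr} (hs : s.Bounded L)
    (h : Q (s.setArr a (i.eval s) (e.eval s))) :
    Runs L (.write a i e) s (i.wt + e.wt + 1) Q := by
  refine ⟨_, _, .write a i e s, ?_, h⟩
  have := e.cost_le hs
  have := i.cost_le hs
  rw [add_mul, add_mul]
  omega

theorem Runs.seq (h : Runs L c₁ s T₁ fun s' => Runs L c₂ s' T₂ Q) :
    Runs L (.seq c₁ c₂) s (T₁ + T₂) Q := by
  obtain ⟨t₁, s₁, h1, h2, t₂, s₂, h3, h4, h5⟩ := h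
  exact ⟨_, _, .seq h1 h3, by rw [add_mul]; omega, h5⟩

theorem Runs.ite {e : Expr} (hs : s.Bounded L) (h₁ : 0 < e.eval s → Runs L c₁ s T Q)
    (h₂ : ¬ 0 < e.eval s → Runs L c₂ s T Q) : Runs L (.ite e c₁ c₂) s (e.wt + T + 1) Q := by
  have := e.cost_le hs
  by_cases h : 0 < e.eval s
  · obtain ⟨t, s', h1, h2, h3⟩ := h₁ h
    exact ⟨_, _, .ite_pos h h1, by rw [add_mul, add_mul]; omega, h3⟩
  · obtain ⟨t, s', h1, h2, h3⟩ := h₂ h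
    exact ⟨_, _, .ite_neg h h1, by rw [add_mul, add_mul]; omega, h3⟩

/-- Rule for loops: the natural number `k` in the invariant `I k` bounds the number of remaining
rounds. -/
theorem Runs.while {e : Expr} (I : ℕ → State → Prop) (hb : ∀ k s, I k s → s.Bounded L)
    (hpos : ∀ k s, I k s → 0 < e.eval s → Runs L c s T fun s' => ∃ k' < k, I k' s')
    (hneg : ∀ k s, I k s → ¬ 0 < e.eval s → Q s) (k : ℕ) :
    ∀ s, I k s → Runs L (.while e c) s ((k + 1) * (T + e.wt + 1)) Q := by
  induction k using Nat.strong_induction_on with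
  | _ k ih =>
    intro s hs
    have hc := e.cost_le (hb k s hs)
    by_cases h : 0 < e.eval s
    · obtain ⟨t₁, s₁, h1, h2, k', hk', h3⟩ := hpos k s hs h
      obtain ⟨t₂, s₂, h4, h5, h6⟩ := ih k' hk' s₁ h3
      refine ⟨_, _, .while_pos h h1 h4, ?_, h6⟩
      calc 1 + e.cost s + t₁ + t₂
          ≤ (1 + e.wt * (L + 1) + T * (L + 1)) + (k' + 1) * (T + e.wt + 1) * (L + 1) := by omega
        _ ≤ (T + e.wt + 1) * (L + 1) + (k' + 1) * (T + e.wt + 1) * (L + 1) := by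
            rw [add_mul (T + e.wt), add_mul T]; omega
        _ = (k' + 2) * (T + e.wt + 1) * (L + 1) := by ring
        _ ≤ _ := Nat.mul_le_mul_right _ (Nat.mul_le_mul_right _ (by omega))
    · refine ⟨_, _, .while_neg h, ?_, hneg k s hs h⟩
      calc 1 + e.cost s ≤ 1 * (T + e.wt + 1) * (L + 1) := by
            rw [one_mul, add_mul, add_mul]; omega
        _ ≤ _ := Nat.mul_le_mul_right _ (Nat.mul_le_mul_right _ (by omega))

/-- `for x = 0, …, eN - 1 do c` -/
def forTo (x : ℕ) (eN : Expr) (c : Program) : Program :=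
  .seq (.assign x (.const 0)) (.while (.bin .sub eN (.var x))
    (.seq c (.assign x (.bin .add (.var x) (.const 1)))))

/-- Running time of `forTo`. -/
def forTime (eN : Expr) (N T : ℕ) : ℕ :=
  ((Expr.const 0).wt + 1) + (N + 1) * (T + ((Expr.bin .add (.var 0) (.const 1)).wt + 1)
    + (Expr.bin .sub eN (.var 0)).wt + 1)

/-- The loop rule with N - k rounds left at counter value k. The body must leave the counter alone;
the invariant for k + 1 is demanded only after the increment. -/
theorem Runs.forTo {x : ℕ} {eN : Expr} (N : ℕ) (I : ℕ → State → Prop) (hs : s.Bounded L)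
    (h0 : I 0 (s.setVar x 0))
    (hI : ∀ k s, k ≤ N → I k s → s.Bounded L ∧ s.var x = k ∧ eN.eval s = N)
    (step : ∀ k s, k < N → I k s → Runs L c s T fun s' =>
      s'.Bounded L ∧ s'.var x = k ∧ I (k + 1) (s'.setVar x ((k + 1 : ℕ) : ℤ))) :
    Runs L (RAM.forTo x eN c) s (forTime eN N T) (I N) := by
  refine Runs.seq (Runs.assign hs ?_)
  refine Runs.while (fun r s => ∃ k, k + r = N ∧ I k s) ?_ ?_ ?_ N _ ⟨0, by omega, h0⟩
  · rintro r s ⟨k, hk, h⟩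
    exact (hI k s (by omega) h).1
  · rintro r s ⟨k, hk, h⟩ hpos
    obtain ⟨h1, h2, h3⟩ := hI k s (by omega) h
    simp only [Expr.eval, Op.eval, h2, h3] at hpos
    have hkN : k < N := by omega
    refine Runs.seq ((step k s hkN h).imp ?_)
    rintro s' ⟨hb, hx, h'⟩
    refine Runs.assign hb ⟨r - 1, by omega, k + 1, by omega, ?_⟩
    simp only [Expr.eval, Op.eval, hx]
    exact_mod_cast h'
  · rintro r s ⟨k, hk, h⟩ hneg
    obtain ⟨h1, h2, h3⟩ := hI k s (by omega) h
    simp only [Expr.eval, Op.eval, h2, h3] at hneg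
    have hkN : k = N := by omega
    exact hkN ▸ h

theorem State.Bounded.setVar {x : ℕ} {z : ℤ} (hs : s.Bounded L) (hz : bits z ≤ L) :
    (s.setVar x z).Bounded L := by
  refine ⟨fun y => ?_, hs.2⟩
  by_cases h : y = x
  · subst h; simpa [State.setVar] using hz
  · simpa [State.setVar, h] using hs.1 y

theorem State.Bounded.setArr {a : ℕ} {i z : ℤ} (hs : s.Bounded L) (hz : bits z ≤ L) :
    (s.setArr a i z).Bounded L := by
  refine ⟨hs.1, fun b j => ?_⟩
  by_cases h : b = a
  · subst h
    by_cases h' : j = i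
    · subst h'; simpa [State.setArr] using hz
    · simpa [State.setArr, h'] using hs.2 b j
  · simpa [State.setArr, h] using hs.2 b j

@[simp] theorem State.setVar_var (s : State) (x : ℕ) (z : ℤ) :
    (s.setVar x z).var = Function.update s.var x z := rfl

@[simp] theorem State.setVar_arr (s : State) (x : ℕ) (z : ℤ) : (s.setVar x z).arr = s.arr := rfl

/-- The state in which the variable `x` has the value `z` and the array `a` the content `f`. -/
def State.put (s : State) (x : ℕ) (z : ℤ) (a : ℕ) (f : ℤ → ℤ) : State where
  var := Function.update s.var x z
  arr := Function.update s.arr a f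

@[simp] theorem State.put_var (s : State) (x : ℕ) (z : ℤ) (a : ℕ) (f : ℤ → ℤ) :
    (s.put x z a f).var = Function.update s.var x z := rfl

@[simp] theorem State.put_arr (s : State) (x : ℕ) (z : ℤ) (a : ℕ) (f : ℤ → ℤ) :
    (s.put x z a f).arr = Function.update s.arr a f := rfl

/-- Store the values of `e` for `x = 0, …, eN - 1` in the array `a`. -/
def fill (x a : ℕ) (eN e : Expr) : Program := forTo x eN (.write a (.var x) e)

/-- Running time of `fill`. -/
def fillTime (eN e : Expr) (N : ℕ) : ℕ := forTime eN N ((Expr.var 0).wt + e.wt + 1)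

/-- The expression must have the right value for every content `f` of the array being filled, so it
must not depend on that array. -/
theorem fill_runs {x a N : ℕ} {eN e : Expr} (hs : s.Bounded L) (g : ℕ → ℤ)
    (hN : ∀ z f, eN.eval (s.put x z a f) = N)
    (he : ∀ k < N, ∀ f, e.eval (s.put x k a f) = g k)
    (hNL : bits N ≤ L) (hg : ∀ k < N, bits (g k) ≤ L) :
    Runs L (fill x a eN e) s (fillTime eN e N) fun s' =>
      s'.Bounded L ∧ ∃ f, s' = s.put x N a f ∧ ∀ k < N, f k = g k := by
  have hk : ∀ k ≤ N, bits (k : ℤ) ≤ L := fun k hk => (bits_mono (by simpa using hk)).trans hNL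
  refine Runs.forTo N (fun k s' => s'.Bounded L ∧ ∃ f, s' = s.put x k a f ∧ ∀ i < k, f i = g i)
    hs ?_ ?_ ?_
  · refine ⟨hs.setVar (by simp [bits]), s.arr a, ?_, by simp⟩
    simp [State.setVar, State.put]
  · rintro k _ hkN ⟨hb, f, rfl, hf⟩
    exact ⟨hb, by simp, hN _ _⟩
  · rintro k _ hkN ⟨hb, f, rfl, hf⟩
    have hz : e.eval (s.put x k a f) = g k := he k hkN f
    refine Runs.write hb ⟨?_, by simp [State.setArr], ?_, Function.update f k (g k), ?_, ?_⟩
    · rw [hz]; exact hb.setArr (hg k hkN)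
    · rw [hz]; exact (hb.setArr (hg k hkN)).setVar (hk _ (by omega))
    · rw [hz]
      simp [State.put, State.setArr, State.setVar, Expr.eval]
    · intro i hi
      rcases Nat.lt_succ_iff_lt_or_eq.1 hi with h | rfl
      · rw [Function.update_of_ne (by exact_mod_cast h.ne), hf i h]
      · simp

end RAM

/-! ### Fraction-free elimination -/

namespace Elimination

open Matrix Finset

/-- The minor of `X` with rows `R` and columns `P`. -/
def minor (X : ℕ → ℕ → ℤ) {ι : Type} [Fintype ι] [DecidableEq ι] (R P : ι → ℕ) : ℤ :=
  det (Matrix.of fun i j => X (R i) (P j))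

/-- Adjoin the index `r` to a family. -/
def snoc {ι : Type} (R : ι → ℕ) (r : ℕ) : ι ⊕ Unit → ℕ := Sum.elim R fun _ => r

/-! ### Sylvester's identity for bordered minors -/

section Sylvester

variable {X : ℕ → ℕ → ℤ} {ι : Type} [Fintype ι] [DecidableEq ι] {R P : ι → ℕ}

/-- The entries of the Schur complement. -/
noncomputable def schur (X : ℕ → ℕ → ℤ) (R P : ι → ℕ) (ρ γ : ℕ) : ℚ :=
  X ρ γ - ∑ j, (∑ i, (X ρ (P i) : ℚ) * (Matrix.of fun i j => (X (R i) (P j) : ℚ))⁻¹ i j) * X (R j) γ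

theorem cast_minor (X : ℕ → ℕ → ℤ) (R P : ι → ℕ) :
    (minor X R P : ℚ) = det (Matrix.of fun i j => (X (R i) (P j) : ℚ)) := by
  exact RingHom.map_det (Int.castRingHom ℚ) _

/-- This is the block formula det A · det(D - C A⁻¹ B). An entry of the Schur complement depends
only on its own row and column index, so the same function `schur` serves all borderings. -/
theorem minor_sum_elim {κ : Type} [Fintype κ] [DecidableEq κ] (h : minor X R P ≠ 0)
    (R' P' : κ → ℕ) :
    (minor X (Sum.elim R R') (Sum.elim P P') : ℚ) =
      minor X R P * det (Matrix.of fun i j => schur X R P (R' i) (P' j)) := by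
  have hA : IsUnit (det (Matrix.of fun i j => (X (R i) (P j) : ℚ))) := by
    rw [← cast_minor]
    exact (Int.cast_ne_zero.2 h).isUnit
  let := Matrix.invertibleOfIsUnitDet _ hA
  have key : (Matrix.of fun i j => (X (Sum.elim R R' i) (Sum.elim P P' j) : ℚ)) =
      fromBlocks (Matrix.of fun i j => (X (R i) (P j) : ℚ)) (Matrix.of fun i j => (X (R i) (P' j) : ℚ))
        (Matrix.of fun i j => (X (R' i) (P j) : ℚ)) (Matrix.of fun i j => (X (R' i) (P' j) : ℚ)) := by
    ext (i | i) (j | j) <;> rfl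
  rw [cast_minor, cast_minor, key, det_fromBlocks₁₁]
  congr 2

theorem minor_snoc (h : minor X R P ≠ 0) (ρ γ : ℕ) :
    (minor X (snoc R ρ) (snoc P γ) : ℚ) = minor X R P * schur X R P ρ γ := by
  rw [snoc, snoc, minor_sum_elim h, det_unique]
  rfl

/-- Sylvester's identity: both sides are the square of the central minor times a 2 × 2 determinant
of Schur complement entries. -/
theorem minor_snoc_snoc (h : minor X R P ≠ 0) (a p ρ γ : ℕ) :
    minor X R P * minor X (snoc (snoc R a) ρ) (snoc (snoc P p) γ) =
      minor X (snoc R a) (snoc P p) * minor X (snoc R ρ) (snoc P γ) -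
      minor X (snoc R a) (snoc P γ) * minor X (snoc R ρ) (snoc P p) := by
  have e : minor X (snoc (snoc R a) ρ) (snoc (snoc P p) γ) =
      minor X (Sum.elim R ![a, ρ]) (Sum.elim P ![p, γ]) := by
    let e' : Unit ⊕ Unit ≃ Fin 2 :=
      { toFun := Sum.elim (fun _ => 0) (fun _ => 1)
        invFun := ![.inl (), .inr ()]
        left_inv := by rintro (_ | _) <;> rfl
        right_inv := by intro i; fin_cases i <;> rfl }
    rw [minor, minor,
      ← det_submatrix_equiv_self ((Equiv.sumAssoc ι Unit Unit).trans (Equiv.sumCongr (.refl ι) e'))]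
    congr 1
    ext ((i | i) | i) ((j | j) | j) <;> rfl
  have : ((minor X R P * minor X (snoc (snoc R a) ρ) (snoc (snoc P p) γ) : ℤ) : ℚ) =
      ((minor X (snoc R a) (snoc P p) * minor X (snoc R ρ) (snoc P γ) -
      minor X (snoc R a) (snoc P γ) * minor X (snoc R ρ) (snoc P p) : ℤ) : ℚ) := by
    push_cast
    rw [e, minor_sum_elim h, det_fin_two, minor_snoc h, minor_snoc h, minor_snoc h, minor_snoc h]
    simp
    ring
  exact_mod_cast this

/-- The Leibniz expansion has one term for each permutation. -/
theorem abs_minor_le {V : ℤ} (hX : ∀ ρ γ, |X ρ γ| ≤ V) (R P : ι → ℕ) :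
    |minor X R P| ≤ (Fintype.card ι).factorial * V ^ Fintype.card ι := by
  have := Matrix.det_le (A := Matrix.of fun i j => X (R i) (P j)) (abv := AbsoluteValue.abs)
    (x := V) (fun i j => hX _ _)
  rwa [AbsoluteValue.abs_apply, nsmul_eq_mul] at this

end Sylvester

/-- `F` consists of the minors of `X` that border a nonzero minor `D` of size at most `k`. -/
def IsBordered (X : ℕ → ℕ → ℤ) (k : ℕ) (F : ℕ → ℕ → ℤ) (D : ℤ) : Prop :=
  D ≠ 0 ∧ ∃ (ι : Type) (_ : Fintype ι) (_ : DecidableEq ι) (R P : ι → ℕ), Fintype.card ι ≤ k ∧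
    D = minor X R P ∧ ∀ ρ γ, F ρ γ = minor X (snoc R ρ) (snoc P γ)

/-- One step of fraction-free elimination, with pivot `F a p`. -/
def elim (F : ℕ → ℕ → ℤ) (D : ℤ) (a p : ℕ) (ρ γ : ℕ) : ℤ :=
  (F a p * F ρ γ - F a γ * F ρ p) / D

/-! ### Exactness and size of fraction-free elimination -/

variable {X F : ℕ → ℕ → ℤ} {k : ℕ} {D : ℤ}

theorem isBordered_init (X : ℕ → ℕ → ℤ) : IsBordered X 0 X 1 := by
  refine ⟨one_ne_zero, Empty, inferInstance, inferInstance, Empty.elim, Empty.elim, by simp,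
    by simp [minor], fun ρ γ => ?_⟩
  have : Subsingleton (Empty ⊕ Unit) := (Equiv.emptySum Empty Unit).subsingleton
  rw [minor, det_eq_elem_of_subsingleton _ (Sum.inr ())]
  rfl

theorem IsBordered.succ (h : IsBordered X k F D) : IsBordered X (k + 1) F D := by
  obtain ⟨hD, ι, _, _, R, P, hc, h⟩ := h
  exact ⟨hD, ι, _, _, R, P, by omega, h⟩

/-- The division in `elim` is exact: by Sylvester's identity the quotient is the minor bordered once
more. -/
theorem IsBordered.mul_elim (h : IsBordered X k F D) (a p ρ γ : ℕ) :
    D * elim F D a p ρ γ = F a p * F ρ γ - F a γ * F ρ p := by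
  obtain ⟨hD, ι, _, _, R, P, hc, rfl, h⟩ := h
  refine Int.mul_ediv_cancel' ?_
  rw [h, h, h, h]
  exact ⟨_, (minor_snoc_snoc hD a p ρ γ).symm⟩

theorem IsBordered.elim (h : IsBordered X k F D) {a p : ℕ} (hp : F a p ≠ 0) :
    IsBordered X (k + 1) (elim F D a p) (F a p) := by
  have h' := h.mul_elim a p
  obtain ⟨hD, ι, _, _, R, P, hc, rfl, h⟩ := h
  refine ⟨hp, ι ⊕ Unit, inferInstance, inferInstance, snoc R a, snoc P p, by simpa using hc,
    h a p, fun ρ γ => ?_⟩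
  apply mul_left_cancel₀ hD
  rw [h', minor_snoc_snoc hD, h, h, h, h]

/-- The entries are minors of order at most k + 1 of the original matrix, so their size does not
compound from step to step. -/
theorem IsBordered.bounds (h : IsBordered X k F D) {m : ℕ} (hk : k ≤ m) {V : ℤ} (hV : 1 ≤ V)
    (hX : ∀ ρ γ, |X ρ γ| ≤ V) :
    |D| ≤ (m + 1).factorial * V ^ (m + 1) ∧
      ∀ ρ γ, |F ρ γ| ≤ (m + 1).factorial * V ^ (m + 1) := by
  obtain ⟨hD, ι, _, _, R, P, hc, rfl, h⟩ := h
  have key : ∀ c ≤ m + 1, (c.factorial * V ^ c : ℤ) ≤ (m + 1).factorial * V ^ (m + 1) := by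
    intro c hc
    gcongr
  refine ⟨(abs_minor_le hX _ _).trans (key _ (by omega)), fun ρ γ => ?_⟩
  rw [h]
  exact (abs_minor_le hX _ _).trans (key _ (by simp; omega))

/-- The matrix `X` describes a solvable linear system in `d` unknowns: the rows `< m` hold the
coefficients in the columns `< d` and the negated right-hand sides in the column `d`, the next `d`
rows hold an identity matrix, and the column `d + 1` is zero. -/
structure IsSystem (X : ℕ → ℕ → ℤ) (m d : ℕ) (w : ℕ → ℤ) : Prop where
  identity : ∀ i < d, ∀ γ, X (m + i) γ = if γ = i then 1 else 0
  zero : ∀ ρ, X ρ (d + 1) = 0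
  solution : ∀ ρ < m, X ρ d + ∑ j ∈ range d, X ρ j * w j = 0

/-- The state of the elimination after `k` rows. -/
structure Invariant (X : ℕ → ℕ → ℤ) (m d : ℕ) (w : ℕ → ℤ) (k : ℕ) (F : ℕ → ℕ → ℤ) (D : ℤ) :
    Prop where
  bordered : IsBordered X k F D
  zero_col : ∀ ρ, F ρ (d + 1) = 0
  zero_row : ∀ ρ < k, ∀ γ ≤ d, F ρ γ = 0
  solution : ∀ ρ, F ρ d + ∑ j ∈ range d, F ρ j * w j =
    D * (X ρ d + ∑ j ∈ range d, X ρ j * w j)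
  combination : ∀ ρ < m, ∀ γ ≤ d, F ρ γ =
    ∑ i ∈ range d, X ρ i * F (m + i) γ + if γ = d then D * X ρ d else 0

/-! ### Elimination as a parametrization of rational solutions -/

variable {m d : ℕ} {w : ℕ → ℤ}

theorem IsSystem.invariant (h : IsSystem X m d w) : Invariant X m d w 0 X 1 where
  bordered := isBordered_init X
  zero_col := h.zero
  zero_row := by simp
  solution := by simp
  combination ρ hρ γ hγ := by
    have : ∀ i ∈ range d, X ρ i * X (m + i) γ = if γ = i then X ρ i else 0 := by
      intro i hi
      rw [h.identity i (by simpa using hi)]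
      simp
    rw [sum_congr rfl this, sum_ite_eq]
    rcases hγ.eq_or_lt with rfl | h
    · simp
    · simp [h, h.ne]

/-- In a row without pivot, solvability of the system forces the entry on the right-hand side to
vanish as well. -/
theorem Invariant.skip (hX : IsSystem X m d w) (h : Invariant X m d w k F D) (hk : k < m)
    (h0 : ∀ γ < d, F k γ = 0) : Invariant X m d w (k + 1) F D where
  bordered := h.bordered.succ
  zero_col := h.zero_col
  zero_row ρ hρ γ hγ := by
    rcases Nat.lt_succ_iff_lt_or_eq.1 hρ with hρ | rfl
    · exact h.zero_row ρ hρ γ hγ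
    · rcases hγ.eq_or_lt with rfl | hγ
      · have := h.solution ρ
        rw [hX.solution ρ hk, sum_eq_zero fun j hj => by rw [h0 j (by simpa using hj), zero_mul]]
          at this
        simpa using this
      · exact h0 γ hγ
  solution := h.solution
  combination := h.combination

/-- The step replaces column γ by a combination of the columns γ and p, divided by the old pivot.
The invariants are linear in the columns, so they persist; each is checked after multiplication by
D. Row k cancels, and rows that were zero stay zero. -/
theorem Invariant.elim (hX : IsSystem X m d w) (h : Invariant X m d w k F D) (hk : k < m)
    {p : ℕ} (hpd : p < d) (hp : F k p ≠ 0) :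
    Invariant X m d w (k + 1) (elim F D k p) (F k p) where
  bordered := h.bordered.elim hp
  zero_col ρ := by simp [Elimination.elim, h.zero_col]
  zero_row ρ hρ γ hγ := by
    rcases Nat.lt_succ_iff_lt_or_eq.1 hρ with hρ | rfl
    · simp [Elimination.elim, h.zero_row ρ hρ γ hγ, h.zero_row ρ hρ p hpd.le]
    · simp [Elimination.elim, mul_comm]
  solution ρ := by
    apply mul_left_cancel₀ h.bordered.1
    have e : D * (Elimination.elim F D k p ρ d +
        ∑ j ∈ range d, Elimination.elim F D k p ρ j * w j) =
        F k p * (F ρ d + ∑ j ∈ range d, F ρ j * w j) -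
        (F k d + ∑ j ∈ range d, F k j * w j) * F ρ p := by
      simp only [mul_add, add_mul, mul_sum, sum_mul, ← mul_assoc, h.bordered.mul_elim]
      rw [add_sub_add_comm, ← sum_sub_distrib]
      congr 1
      exact sum_congr rfl fun j _ => by ring
    rw [e, h.solution, h.solution, hX.solution k hk]
    ring
  combination ρ hρ γ hγ := by
    apply mul_left_cancel₀ h.bordered.1
    rw [mul_add, mul_sum, h.bordered.mul_elim, h.combination ρ hρ γ hγ,
      h.combination ρ hρ p hpd.le, if_neg hpd.ne]
    have : ∀ i, D * (X ρ i * Elimination.elim F D k p (m + i) γ) =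
        F k p * (X ρ i * F (m + i) γ) - F k γ * (X ρ i * F (m + i) p) := by
      intro i
      rw [mul_left_comm, h.bordered.mul_elim]
      ring
    simp only [this, sum_sub_distrib, ← mul_sum]
    split_ifs <;> ring

/-- A vector that is integral in the parametrization of the rational solutions is a solution. -/
theorem Invariant.isSolution (h : Invariant X m d w m F D) {t u : ℕ → ℤ}
    (hu : ∀ i < d, D * u i = F (m + i) d + ∑ j ∈ range d, F (m + i) j * t j) :
    ∀ ρ < m, X ρ d + ∑ i ∈ range d, X ρ i * u i = 0 := by
  intro ρ hρ
  have hd := h.combination ρ hρ d le_rfl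
  rw [h.zero_row ρ hρ d le_rfl, if_pos rfl] at hd
  have hj : ∀ j ∈ range d, ∑ i ∈ range d, X ρ i * F (m + i) j = 0 := by
    intro j hj
    rw [mem_range] at hj
    have := h.combination ρ hρ j hj.le
    rw [h.zero_row ρ hρ j hj.le, if_neg hj.ne, add_zero] at this
    exact this.symm
  apply mul_left_cancel₀ h.bordered.1
  -- The parameters `t` drop out, because by `hj` the lower parts of the columns below `d` lie in
  -- the kernel of the system.
  have e : ∑ i ∈ range d, D * (X ρ i * u i) = ∑ i ∈ range d, X ρ i * F (m + i) d := by
    rw [← sub_eq_zero, ← sum_sub_distrib]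
    have : ∀ i ∈ range d, D * (X ρ i * u i) - X ρ i * F (m + i) d =
        ∑ j ∈ range d, X ρ i * F (m + i) j * t j := by
      intro i hi
      rw [mul_left_comm, hu i (by simpa using hi), mul_add, add_sub_cancel_left, mul_sum]
      exact sum_congr rfl fun j _ => by ring
    rw [sum_congr rfl this, sum_comm]
    exact sum_eq_zero fun j hj' => by rw [← sum_mul, hj j hj', zero_mul]
  rw [mul_add, mul_sum, e]
  linarith

/-- The given integral solution is contained in the parametrization. -/
theorem Invariant.solution_eq (hX : IsSystem X m d w) (h : Invariant X m d w k F D) :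
    ∀ i < d, F (m + i) d + ∑ j ∈ range d, F (m + i) j * w j = D * w i := by
  intro i hi
  rw [h.solution, hX.identity i hi, if_neg hi.ne', zero_add]
  congr 1
  rw [sum_congr rfl fun j _ => by rw [hX.identity i hi]]
  simp [hi]

end Elimination

/-! ### Linear congruences by Euclid's algorithm on columns -/

namespace Congruence

open Finset

/-- Put `E` times the `i`-th unit vector into the column `d + 1`. -/
def reset (d : ℕ) (E : ℤ) (i : ℕ) (G : ℕ → ℕ → ℤ) (ρ γ : ℕ) : ℤ :=
  if γ = d + 1 then if ρ = i then E else 0 else G ρ γ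

/-- One division step of Euclid's algorithm for the columns `d + 1` and `j`, with respect to their
entries in row `i`. -/
def euclid (d : ℕ) (E : ℤ) (i j : ℕ) (G : ℕ → ℕ → ℤ) (ρ γ : ℕ) : ℤ :=
  if γ = d + 1 then G ρ j
  else if γ = j then (G ρ (d + 1) - G i (d + 1) / G i j * G ρ j) % E else G ρ γ

/-- Clear the entry of the column `d` in row `i` by means of the column `d + 1`. -/
def reduce (d : ℕ) (E : ℤ) (i : ℕ) (G : ℕ → ℕ → ℤ) (ρ γ : ℕ) : ℤ :=
  if γ = d then (G ρ d - G i d / G i (d + 1) * G ρ (d + 1)) % E else G ρ γ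

/-- The deviation of the upper half of `v` from the image under `M` of its lower half. -/
def defect (M : ℕ → ℕ → ℤ) (d : ℕ) (v : ℕ → ℤ) (ρ : ℕ) : ℤ :=
  v ρ - ∑ k ∈ range d, M ρ k * v (d + k)

variable {M : ℕ → ℕ → ℤ} {y : ℕ → ℤ} {d : ℕ} {E : ℤ} {i j : ℕ} {G : ℕ → ℕ → ℤ}

/-- The defect is linear, and reducing a vector modulo E changes it by a multiple of E. Hence column
operations with reduction act on defects as if no reduction took place. -/
theorem dvd_defect {u a b : ℕ → ℤ} {q : ℤ} (h : ∀ ρ, u ρ = (a ρ - q * b ρ) % E) (ρ : ℕ) :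
    E ∣ defect M d u ρ - (defect M d a ρ - q * defect M d b ρ) := by
  have h' : ∀ ρ, u ρ = a ρ - q * b ρ - E * ((a ρ - q * b ρ) / E) := fun ρ => by
    rw [h, Int.emod_def]
  refine ⟨-defect M d (fun ρ => (a ρ - q * b ρ) / E) ρ, ?_⟩
  simp only [defect, h', mul_sub, sum_sub_distrib, mul_sum, neg_sub]
  simp only [← mul_assoc, mul_comm (M _ _) q, mul_comm (M _ _) E]
  ring

theorem dvd_emod_sub (x : ℤ) : E ∣ x % E - x := by
  rw [Int.emod_def]
  exact ⟨-(x / E), by ring⟩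

theorem sum_change {f g : ℕ → ℤ} (hj : j < d) (h : ∀ k < d, k ≠ j → f k = g k) :
    ∑ k ∈ range d, f k = ∑ k ∈ range d, g k + (f j - g j) := by
  rw [← add_sum_erase _ f (mem_range.2 hj), ← add_sum_erase _ g (mem_range.2 hj),
    sum_congr rfl fun k hk => h k (mem_range.1 (mem_of_mem_erase hk)) (ne_of_mem_erase hk)]
  ring

/-- The state after the first `i` congruences have been solved. The columns `< d` generate the
solutions of the homogeneous congruences; the lower half of the column `d` is a solution. -/
structure Outer (M : ℕ → ℕ → ℤ) (y : ℕ → ℤ) (d : ℕ) (E : ℤ) (i : ℕ) (G : ℕ → ℕ → ℤ) : Prop where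
  nonneg : ∀ ρ γ, 0 ≤ G ρ γ
  le : ∀ ρ γ, G ρ γ ≤ E
  sound : ∀ γ < d, ∀ ρ < d, E ∣ defect M d (fun ρ => G ρ γ) ρ
  sound' : ∀ ρ < d, E ∣ defect M d (fun ρ => G ρ d) ρ - y ρ
  zero : ∀ ρ < i, ∀ γ ≤ d, G ρ γ = 0
  complete : ∃ x : ℕ → ℤ, ∀ ρ < d, E ∣ G ρ d + ∑ k ∈ range d, x k * G ρ k

/-- The state in which, moreover, the entries in row `i` of the first `j` columns are cleared. -/
structure Inner (M : ℕ → ℕ → ℤ) (y : ℕ → ℤ) (d : ℕ) (E : ℤ) (i j : ℕ) (G : ℕ → ℕ → ℤ) :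
    Prop where
  nonneg : ∀ ρ γ, 0 ≤ G ρ γ
  le : ∀ ρ γ, G ρ γ ≤ E
  sound : ∀ γ ≤ d + 1, γ ≠ d → ∀ ρ < d, E ∣ defect M d (fun ρ => G ρ γ) ρ
  sound' : ∀ ρ < d, E ∣ defect M d (fun ρ => G ρ d) ρ - y ρ
  zero : ∀ ρ < i, ∀ γ ≤ d + 1, G ρ γ = 0
  cleared : ∀ γ < j, G i γ = 0
  pos : 0 < G i (d + 1)
  complete : ∃ (x : ℕ → ℤ) (s : ℤ),
    (G i d + ∑ k ∈ range d, x k * G i k + s * G i (d + 1) = 0) ∧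
    ∀ ρ < d, E ∣ G ρ d + ∑ k ∈ range d, x k * G ρ k + s * G ρ (d + 1)

/-- The column E · e_i expresses the freedom to alter row i by multiples of E. The quotient `c` of
the congruence in row i supplies its coefficient `-c`, which turns that congruence into an equation.
-/
theorem Outer.inner (hE : 0 < E) (h : Outer M y d E i G) (hi : i < d) :
    Inner M y d E i 0 (reset d E i G) where
  nonneg ρ γ := by
    unfold reset
    split_ifs
    exacts [hE.le, le_rfl, h.nonneg ρ γ]
  le ρ γ := by
    unfold reset
    split_ifs
    exacts [le_rfl, hE.le, h.le ρ γ]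
  sound γ hγ hγd ρ hρ := by
    rcases hγ.eq_or_lt with rfl | hγ
    · refine dvd_sub ?_ (dvd_sum fun k hk => Dvd.dvd.mul_left ?_ _) <;>
      · simp only [reset, if_true]
        split_ifs <;> simp
    · have : γ < d := by omega
      simpa [reset, hγ.ne] using h.sound γ this ρ hρ
  sound' ρ hρ := by simpa [reset] using h.sound' ρ hρ
  zero ρ hρ γ hγ := by
    rcases hγ.eq_or_lt with rfl | hγ
    · simp [reset, hρ.ne]
    · simpa [reset, hγ.ne] using h.zero ρ hρ γ (by omega)
  cleared := by simp
  pos := by simpa [reset] using hE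
  complete := by
    obtain ⟨x, hx⟩ := h.complete
    obtain ⟨c, hc⟩ := hx i hi
    have e : ∀ ρ, ∑ k ∈ range d, x k * reset d E i G ρ k = ∑ k ∈ range d, x k * G ρ k := by
      intro ρ
      refine sum_congr rfl fun k hk => ?_
      have : k ≠ d + 1 := by have := mem_range.1 hk; omega
      simp [reset, this]
    refine ⟨x, -c, ?_, fun ρ hρ => ?_⟩
    · rw [e]
      simp only [reset, if_true, show d ≠ d + 1 by omega, if_false]
      rw [hc]
      ring
    · rw [e]
      refine dvd_add ?_ (Dvd.dvd.mul_left ?_ _)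
      · simpa [reset] using hx ρ hρ
      · simp only [reset, if_true]
        split_ifs <;> simp

/-- Reduction modulo E does not disturb Euclid's algorithm in row i: the remainder is smaller than a
divisor that is at most E. -/
theorem Inner.entry (h : Inner M y d E i j G) (hj : j < d) (hp : 0 < G i j) :
    euclid d E i j G i j = G i (d + 1) % G i j := by
  have h1 : G i (d + 1) - G i (d + 1) / G i j * G i j = G i (d + 1) % G i j := by
    rw [Int.emod_def, mul_comm]
  have h2 := Int.emod_nonneg (G i (d + 1)) hp.ne'
  have h3 := Int.emod_lt_of_pos (G i (d + 1)) hp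
  have : j ≠ d + 1 := by omega
  simp only [euclid, this, if_false, if_true, h1]
  exact Int.emod_eq_of_lt h2 (h3.trans_le (h.le _ _))

/-- Modulo E a division step is an invertible operation on two columns, so neither the
correspondence of upper and lower halves nor solvability is lost. In row i it is exact. -/
theorem Inner.euclid (hE : 0 < E) (h : Inner M y d E i j G) (hj : j < d) (hp : 0 < G i j) :
    Inner M y d E i j (euclid d E i j G) where
  nonneg ρ γ := by
    unfold Congruence.euclid
    split_ifs
    exacts [h.nonneg _ _, Int.emod_nonneg _ hE.ne', h.nonneg _ _]
  le ρ γ := by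
    unfold Congruence.euclid
    split_ifs
    exacts [h.le _ _, (Int.emod_lt_of_pos _ hE).le, h.le _ _]
  sound γ hγ hγd ρ hρ := by
    have hs := h.sound (d + 1) le_rfl (by omega) ρ hρ
    have hj' := h.sound j (by omega) hj.ne ρ hρ
    by_cases h1 : γ = d + 1
    · subst h1
      simpa [Congruence.euclid] using hj'
    · by_cases h2 : γ = j
      · subst h2
        have := dvd_defect (M := M) (d := d) (E := E)
          (u := fun ρ => Congruence.euclid d E i γ G ρ γ)
          (a := fun ρ => G ρ (d + 1)) (b := fun ρ => G ρ γ) (q := G i (d + 1) / G i γ)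
          (fun ρ => by simp [Congruence.euclid, h1]) ρ
        exact (dvd_iff_dvd_of_dvd_sub this).2 (dvd_sub hs (Dvd.dvd.mul_left hj' _))
      · simpa [Congruence.euclid, h1, h2] using h.sound γ hγ hγd ρ hρ
  sound' ρ hρ := by
    simpa [Congruence.euclid, hj.ne'] using h.sound' ρ hρ
  zero ρ hρ γ hγ := by
    unfold Congruence.euclid
    split_ifs
    · exact h.zero ρ hρ j (by omega)
    · simp [h.zero ρ hρ j (by omega), h.zero ρ hρ (d + 1) le_rfl]
    · exact h.zero ρ hρ γ hγ
  cleared γ hγ := by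
    have h1 : γ ≠ d + 1 := by omega
    have h2 : γ ≠ j := by omega
    simpa [Congruence.euclid, h1, h2] using h.cleared γ hγ
  pos := by simpa [Congruence.euclid] using hp
  complete := by
    obtain ⟨x, s, h1, h2⟩ := h.complete
    set q := G i (d + 1) / G i j with hq
    have hjs : j ≠ d + 1 := by omega
    have e : ∀ ρ, ∑ k ∈ range d, Function.update x j s k * Congruence.euclid d E i j G ρ k =
        ∑ k ∈ range d, x k * G ρ k + (s * Congruence.euclid d E i j G ρ j - x j * G ρ j) := by
      intro ρ
      rw [sum_change (g := fun k => x k * G ρ k) hj, Function.update_self]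
      intro k hk hkj
      have : k ≠ d + 1 := by omega
      simp [Congruence.euclid, this, hkj]
    have e1 : ∀ ρ, Congruence.euclid d E i j G ρ d = G ρ d := fun ρ => by
      simp [Congruence.euclid, hj.ne']
    have e2 : ∀ ρ, Congruence.euclid d E i j G ρ (d + 1) = G ρ j := fun ρ => by
      simp [Congruence.euclid]
    -- The old column `d + 1` is the new column `j` plus `q` times the new column `d + 1`, and the
    -- old column `j` is the new column `d + 1`; collecting coefficients gives these witnesses.
    refine ⟨Function.update x j s, x j + q * s, ?_, fun ρ hρ => ?_⟩
    · rw [e, e1, e2, h.entry hj hp, Int.emod_def, mul_comm (G i j)]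
      linear_combination h1
    · rw [e, e1, e2]
      obtain ⟨c, hc⟩ := h2 ρ hρ
      have e3 : Congruence.euclid d E i j G ρ j = (G ρ (d + 1) - q * G ρ j) % E := by
        simp [Congruence.euclid, hjs, hq]
      obtain ⟨c', hc'⟩ := dvd_emod_sub (E := E) (G ρ (d + 1) - q * G ρ j)
      rw [← e3] at hc'
      exact ⟨c + s * c', by linear_combination hc + s * hc'⟩

/-- A bound for the number of remaining division steps of Euclid's algorithm. -/
def measure (a b : ℤ) : ℕ := a.natAbs.size + b.natAbs.size + if a < b then 1 else 0

/-- If a < b, the step merely swaps the two numbers and the order flag drops. Otherwise a % b is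
less than half of a, which loses at least one bit. -/
theorem measure_lt {a b : ℤ} (hb : 0 < b) (ha : 0 < a) : measure b (a % b) < measure a b := by
  have h1 := Int.emod_nonneg a hb.ne'
  have h2 := Int.emod_lt_of_pos a hb
  unfold measure
  rw [if_neg h2.not_gt]
  split_ifs with h
  · rw [Int.emod_eq_of_lt ha.le h]
    omega
  · push Not at h
    have h3 : 2 * (a % b) < a := by
      have h4 := Int.emod_add_mul_ediv a b
      have h5 : 1 ≤ a / b := (Int.le_ediv_iff_mul_le hb).2 (by linarith)
      nlinarith
    have : (a % b).natAbs.size < a.natAbs.size := by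
      rw [Nat.lt_size]
      rcases Nat.eq_zero_or_pos (a % b).natAbs with h0 | h0
      · rw [h0]
        simp
        omega
      · have : 2 ^ ((a % b).natAbs.size - 1) ≤ (a % b).natAbs := by
          rw [← Nat.lt_size]
          have := Nat.size_pos.2 h0
          omega
        have e : (a % b).natAbs.size = (a % b).natAbs.size - 1 + 1 := by
          have := Nat.size_pos.2 h0
          omega
        rw [e, pow_succ]
        omega
    omega

theorem Inner.measure_lt (h : Inner M y d E i j G) (hj : j < d) (hp : 0 < G i j) :
    measure (Congruence.euclid d E i j G i (d + 1)) (Congruence.euclid d E i j G i j) <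
      measure (G i (d + 1)) (G i j) := by
  rw [h.entry hj hp]
  simpa [Congruence.euclid] using Congruence.measure_lt hp h.pos

theorem Inner.next (h : Inner M y d E i j G) (hp : ¬ 0 < G i j) : Inner M y d E i (j + 1) G :=
  { h with
    cleared := fun γ hγ => by
      rcases Nat.lt_succ_iff_lt_or_eq.1 hγ with hγ | rfl
      · exact h.cleared γ hγ
      · exact le_antisymm (not_lt.1 hp) (h.nonneg _ _) }

/-- With row i cleared in the columns below `d`, the equation of `complete` reads G i d + s · G i (d
+ 1) = 0. So the division is exact with quotient `-s`, and after subtraction the same coefficients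
`x` work without the column `d + 1`. -/
theorem Inner.reduce (hE : 0 < E) (hi : i < d) (h : Inner M y d E i d G) :
    Outer M y d E (i + 1) (reduce d E i G) := by
  have hsum : ∀ x : ℕ → ℤ, ∑ k ∈ range d, x k * G i k = 0 := fun x =>
    sum_eq_zero fun k hk => by rw [h.cleared k (mem_range.1 hk), mul_zero]
  obtain ⟨x, s, h1, h2⟩ := h.complete
  rw [hsum, add_zero] at h1
  have hs : G i d / G i (d + 1) = -s :=
    Int.ediv_eq_of_eq_mul_left h.pos.ne' (by linear_combination h1)
  have ed : ∀ ρ, Congruence.reduce d E i G ρ d = (G ρ d + s * G ρ (d + 1)) % E := fun ρ => by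
    simp [Congruence.reduce, hs]
  have ene : ∀ ρ γ, γ ≠ d → Congruence.reduce d E i G ρ γ = G ρ γ := fun ρ γ hγ => by
    simp [Congruence.reduce, hγ]
  refine ⟨fun ρ γ => ?_, fun ρ γ => ?_, fun γ hγ ρ hρ => ?_, fun ρ hρ => ?_, fun ρ hρ γ hγ => ?_,
    x, fun ρ hρ => ?_⟩
  · unfold Congruence.reduce
    split_ifs
    exacts [Int.emod_nonneg _ hE.ne', h.nonneg _ _]
  · unfold Congruence.reduce
    split_ifs
    exacts [(Int.emod_lt_of_pos _ hE).le, h.le _ _]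
  · simp only [ene _ γ hγ.ne]
    exact h.sound γ (by omega) hγ.ne ρ hρ
  · have h3 := dvd_defect (M := M) (d := d) (E := E)
      (u := fun ρ => Congruence.reduce d E i G ρ d)
      (a := fun ρ => G ρ d) (b := fun ρ => G ρ (d + 1)) (q := -s)
      (fun ρ => by simp [ed]) ρ
    obtain ⟨c, hc⟩ := h3
    obtain ⟨c₁, hc₁⟩ := h.sound' ρ hρ
    obtain ⟨c₂, hc₂⟩ := h.sound (d + 1) le_rfl (by omega) ρ hρ
    exact ⟨c + c₁ + s * c₂, by linear_combination hc + hc₁ + s * hc₂⟩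
  · rcases Nat.lt_succ_iff_lt_or_eq.1 hρ with hρ | rfl
    · unfold Congruence.reduce
      split_ifs
      · simp [h.zero ρ hρ d (by omega), h.zero ρ hρ (d + 1) le_rfl]
      · exact h.zero ρ hρ γ (by omega)
    · rcases hγ.eq_or_lt with rfl | hγ
      · rw [ed, h1, Int.zero_emod]
      · rw [ene _ _ hγ.ne, h.cleared γ hγ]
  · obtain ⟨c, hc⟩ := h2 ρ hρ
    obtain ⟨c', hc'⟩ := dvd_emod_sub (E := E) (G ρ d + s * G ρ (d + 1))
    rw [← ed] at hc'
    rw [sum_congr rfl fun k hk => by rw [ene ρ k (mem_range.1 hk).ne]]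
    exact ⟨c + c', by linear_combination hc + hc'⟩

/-- The upper half of column `d` is zero, so its defect is minus the image of the lower half, and it
is congruent to `y`. -/
theorem Outer.dvd (h : Outer M y d E d G) :
    ∀ ρ < d, E ∣ y ρ + ∑ k ∈ range d, M ρ k * G (d + k) d := by
  intro ρ hρ
  have := h.sound' ρ hρ
  rw [defect, h.zero ρ hρ d le_rfl] at this
  obtain ⟨c, hc⟩ := this
  exact ⟨-c, by linear_combination -hc⟩

/-- The initial state. -/
def start (M : ℕ → ℕ → ℤ) (d : ℕ) (E : ℤ) (ρ γ : ℕ) : ℤ :=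
  if ρ < d then M ρ γ % E else if γ = ρ - d then 1 else 0

theorem outer_start (hE : 0 < E) {w : ℕ → ℤ}
    (hw : ∀ ρ < d, E ∣ M ρ d + ∑ k ∈ range d, M ρ k * w k) :
    Outer M (fun ρ => M ρ d) d E 0 (start M d E) := by
  -- The lower half is the identity in the columns below `d` and zero in column `d`; only in the
  -- former is the entry of `M` subtracted.
  have key : ∀ γ ≤ d, ∀ ρ < d, defect M d (fun ρ => start M d E ρ γ) ρ =
      M ρ γ % E - if γ < d then M ρ γ else 0 := by
    intro γ hγ ρ hρ
    have : ∀ k ∈ range d, M ρ k * start M d E (d + k) γ = if γ = k then M ρ k else 0 := by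
      intro k hk
      simp [start]
    rw [defect, sum_congr rfl this]
    simp [start, hρ]
  refine ⟨fun ρ γ => ?_, fun ρ γ => ?_, fun γ hγ ρ hρ => ?_, fun ρ hρ => ?_, by simp,
    w, fun ρ hρ => ?_⟩
  · unfold start
    split_ifs
    exacts [Int.emod_nonneg _ hE.ne', zero_le_one, le_rfl]
  · unfold start
    split_ifs
    exacts [(Int.emod_lt_of_pos _ hE).le, hE, hE.le]
  · rw [key γ hγ.le ρ hρ, if_pos hγ]
    exact dvd_emod_sub _
  · rw [key d le_rfl ρ hρ, if_neg (lt_irrefl d), sub_zero]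
    exact dvd_emod_sub _
  · have : E ∣ (start M d E ρ d + ∑ k ∈ range d, w k * start M d E ρ k) -
        (M ρ d + ∑ k ∈ range d, M ρ k * w k) := by
      rw [add_sub_add_comm, ← sum_sub_distrib]
      refine dvd_add ?_ (dvd_sum fun k hk => ?_)
      · simpa [start, hρ] using dvd_emod_sub (E := E) (M ρ d)
      · rw [mul_comm (M ρ k), ← mul_sub]
        refine Dvd.dvd.mul_left ?_ _
        simpa [start, hρ] using dvd_emod_sub (E := E) (M ρ k)
    exact (dvd_iff_dvd_of_dvd_sub this).2 (hw ρ hρ)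

end Congruence

/-! ### Sample complexity -/

namespace PAC

open Finset

/-! ### Exchangeability and Markov's inequality -/

section

variable {α : Type} [Fintype α]

open scoped Classical in
theorem prob_le_prob (D : PMF α) {E E' : α → Prop} (h : ∀ a, E a → E' a) : prob D E ≤ prob D E' := by
  refine sum_le_sum fun a _ => ?_
  by_cases h1 : E a
  · simp [h1, h a h1]
  · rw [if_neg h1]
    split_ifs <;> simp

open scoped Classical in
theorem iidProb_mono (D : PMF α) {m : ℕ} {E E' : (Fin m → α) → Prop} (h : ∀ x, E x → E' x) :
    iidProb D m E ≤ iidProb D m E' := by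
  refine sum_le_sum fun x _ => ?_
  have : 0 ≤ ∏ i, (D (x i)).toReal := prod_nonneg fun _ _ => ENNReal.toReal_nonneg
  by_cases h1 : E x
  · simp [h1, h x h1]
  · rw [if_neg h1]
    split_ifs <;> simp [this]

theorem sum_toReal (D : PMF α) : ∑ a, (D a).toReal = 1 := by
  have := D.tsum_coe
  rw [tsum_fintype] at this
  rw [← ENNReal.toReal_sum fun a _ => D.apply_ne_top a, this, ENNReal.toReal_one]

theorem sum_prod_toReal (D : PMF α) (m : ℕ) : ∑ x : Fin m → α, ∏ i, (D (x i)).toReal = 1 := by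
  have := (prod_univ_sum (fun _ : Fin m => (univ : Finset α)) fun _ a => (D a).toReal).symm
  rw [Fintype.piFinset_univ] at this
  rw [this]
  simp [sum_toReal]

open scoped Classical in
theorem iidProb_not (D : PMF α) {m : ℕ} (E : (Fin m → α) → Prop) :
    iidProb D m (fun x => ¬ E x) = 1 - iidProb D m E := by
  rw [eq_sub_iff_add_eq, iidProb, iidProb, ← sum_add_distrib, ← sum_prod_toReal D m]
  refine sum_congr rfl fun x _ => ?_
  by_cases h : E x <;> simp [h]

open scoped Classical in
/-- Markov's inequality. -/
theorem iidProb_le_mul_le (D : PMF α) {m : ℕ} {f : (Fin m → α) → ℝ} (hf : ∀ x, 0 ≤ f x) (ε : ℝ) :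
    ε * iidProb D m (fun x => ε ≤ f x) ≤ ∑ x : Fin m → α, (∏ i, (D (x i)).toReal) * f x := by
  rw [iidProb, mul_sum]
  refine sum_le_sum fun x _ => ?_
  have : 0 ≤ ∏ i, (D (x i)).toReal := prod_nonneg fun _ _ => ENNReal.toReal_nonneg
  split_ifs with h
  · rw [mul_comm]
    gcongr
  · rw [mul_zero]
    exact mul_nonneg this (hf x)

variable {V : Type} [AddCommGroup V] [Module ℚ V] [FiniteDimensional ℚ V] (φ : α → V)

open scoped Classical in
/-- At most `dim V` members of a finite family are outside the span of the others. -/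
theorem card_notMem_span_le {ι : Type} [Fintype ι] (v : ι → V) :
    #{i | v i ∉ Submodule.span ℚ (v '' {j | j ≠ i})} ≤ Module.finrank ℚ V := by
  set s : Finset ι := {i | v i ∉ Submodule.span ℚ (v '' {j | j ≠ i})} with hs
  have : LinearIndependent ℚ fun i : s => v i := by
    rw [linearIndependent_iff_notMem_span]
    intro i hi
    have h2 := (mem_filter.1 i.2).2
    refine h2 (Submodule.span_mono ?_ hi)
    rintro _ ⟨j, hj, rfl⟩
    exact ⟨j, fun h => hj.2 (Subtype.ext h), rfl⟩
  simpa using this.fintype_card_le_finrank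

-- The left side is the expected number of indices among m + 1 independent draws whose vector is
-- outside the span of the others. Each index contributes equally by symmetry, and for every outcome
-- the number is at most the dimension.
open scoped Classical in
theorem expectation_notMem_span_le (D : PMF α) (m : ℕ) :
    (m + 1 : ℝ) * ∑ x : Fin m → α, (∏ i, (D (x i)).toReal) *
      prob D (fun a => φ a ∉ Submodule.span ℚ (Set.range (φ ∘ x))) ≤ Module.finrank ℚ V := by
  let f (i : Fin (m + 1)) (y : Fin (m + 1) → α) : ℝ :=
    if (φ ∘ y) i ∉ Submodule.span ℚ ((φ ∘ y) '' {j | j ≠ i}) then 1 else 0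
  let S (i : Fin (m + 1)) : ℝ := ∑ y : Fin (m + 1) → α, (∏ k, (D (y k)).toReal) * f i y
  have hS0 : ∑ x : Fin m → α, (∏ i, (D (x i)).toReal) *
      prob D (fun a => φ a ∉ Submodule.span ℚ (Set.range (φ ∘ x))) = S 0 := by
    simp only [S]
    -- Draw 0 plays the fresh point, the remaining draws are the sample.
    rw [← (Fin.consEquiv fun _ : Fin (m + 1) => α).sum_comp, Fintype.sum_prod_type, sum_comm]
    refine sum_congr rfl fun x _ => ?_
    rw [prob, mul_sum]
    refine sum_congr rfl fun a _ => ?_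
    have e : Set.range (φ ∘ x) =
        (φ ∘ (Fin.cons a x : Fin (m + 1) → α)) '' {j | j ≠ 0} := by
      ext v
      constructor
      · rintro ⟨i, rfl⟩
        exact ⟨i.succ, Fin.succ_ne_zero i, by simp⟩
      · rintro ⟨j, hj, rfl⟩
        obtain ⟨i, rfl⟩ := Fin.exists_succ_eq.2 hj
        exact ⟨i, by simp⟩
    have e' : f 0 (Fin.cons a x) =
        if φ a ∉ Submodule.span ℚ (Set.range (φ ∘ x)) then 1 else 0 := by
      simp only [f]
      rw [← e]
      rfl
    simp only [Fin.consEquiv, Equiv.coe_fn_mk, Fin.prod_univ_succ, Fin.cons_zero, Fin.cons_succ, e']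
    split_ifs <;> ring
  have hSi : ∀ i, S i = S 0 := by
    intro i
    simp only [S]
    -- Exchanging the draws `i` and 0 preserves the product distribution.
    rw [← (Equiv.arrowCongr (Equiv.swap i 0) (Equiv.refl α)).sum_comp]
    refine sum_congr rfl fun y _ => ?_
    congr 1
    · exact Equiv.prod_comp (Equiv.swap i 0) fun k => (D (y k)).toReal
    · have e : (φ ∘ (Equiv.arrowCongr (Equiv.swap i 0) (Equiv.refl α)) y) '' {j | j ≠ i} =
          (φ ∘ y) '' {j | j ≠ 0} := by
        have : (φ ∘ (Equiv.arrowCongr (Equiv.swap i 0) (Equiv.refl α)) y) =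
            (φ ∘ y) ∘ Equiv.swap i 0 := rfl
        rw [this, Set.image_comp]
        congr 1
        ext j
        rw [Equiv.image_eq_preimage_symm]
        simp [Equiv.swap_apply_eq_iff]
      simp only [f, e]
      simp
  calc _ = ∑ i, S i := by simp [hSi, hS0]
    _ = ∑ y : Fin (m + 1) → α, (∏ k, (D (y k)).toReal) * ∑ i, f i y := by
        simp only [S, mul_sum]
        exact sum_comm
    _ ≤ ∑ y : Fin (m + 1) → α, (∏ k, (D (y k)).toReal) * Module.finrank ℚ V := by
        gcongr with y
        simp only [f, sum_boole]
        exact_mod_cast card_notMem_span_le (φ ∘ y)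
    _ = _ := by rw [← sum_mul, sum_prod_toReal, one_mul]

/-- With high probability, the span of sufficiently many samples contains almost all points. -/
theorem le_iidProb_notMem_span_lt (D : PMF α) {m : ℕ} {ε δ : ℝ} (hε : 0 < ε)
    (hm : Module.finrank ℚ V ≤ δ * (ε * (m + 1))) :
    1 - δ ≤ iidProb D m fun x =>
      prob D (fun a => φ a ∉ Submodule.span ℚ (Set.range (φ ∘ x))) < ε := by
  have h1 := expectation_notMem_span_le φ D m
  have h2 := iidProb_le_mul_le D (m := m)
    (f := fun x => prob D (fun a => φ a ∉ Submodule.span ℚ (Set.range (φ ∘ x))))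
    (fun x => by
      unfold prob
      exact sum_nonneg fun a _ => by split_ifs <;> simp) ε
  have h3 := iidProb_not D (m := m) fun x =>
    ε ≤ prob D (fun a => φ a ∉ Submodule.span ℚ (Set.range (φ ∘ x)))
  simp only [not_le] at h3
  rw [h3, sub_le_sub_iff_left]
  have hm' : (0 : ℝ) < m + 1 := by positivity
  have h4 : (m + 1) * (ε * iidProb D m fun x =>
      ε ≤ prob D (fun a => φ a ∉ Submodule.span ℚ (Set.range (φ ∘ x)))) ≤ δ * (ε * (m + 1)) :=
    (mul_le_mul_of_nonneg_left h2 hm'.le).trans (h1.trans hm)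
  refine le_of_mul_le_mul_left (a := ε * (m + 1)) ?_ (by positivity)
  linarith

end

/-- A consistent learner for a class of games whose differences are linear functionals on a space
of dimension at most `n ^ 2` is a PAC learner of polynomial sample complexity. -/
theorem exists_pacLearns {C : GameClass} {L : RAM.Program} (hL : IsConsistentLearner C L)
    (V : ℕ → Type) [∀ n, AddCommGroup (V n)] [∀ n, Module ℚ (V n)]
    [∀ n, FiniteDimensional ℚ (V n)] (hV : ∀ n, Module.finrank ℚ (V n) ≤ n ^ 2)
    (φ : ∀ n, Finset (Fin n) → V n)
    (hφ : ∀ n (f h : C.Rep n), ∃ l : V n →ₗ[ℚ] ℚ, ∀ S,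
      l (φ n S) = C.value n f S - C.value n h S) :
    ∃ m₀ : ℕ → ℝ → ℝ → ℕ, PolynomiallyBounded m₀ ∧ PACLearns C L m₀ := by
  -- The summand 1 of the polynomial absorbs the rounding up.
  refine ⟨fun n ε δ => ⌈(n : ℝ) ^ 2 * (1 / ε) * (1 / δ)⌉₊,
    ⟨.X 0 ^ 2 * .X 1 * .X 2 + 1, fun n ε δ hε hδ => ?_⟩, fun n f ε δ hε hδ D m hm => ?_⟩
  · simpa using (Nat.ceil_lt_add_one (a := (n : ℝ) ^ 2 * (1 / ε) * (1 / δ)) (by positivity)).le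
  · have h1 : (n : ℝ) ^ 2 * (1 / ε) * (1 / δ) ≤ m := Nat.ceil_le.1 hm
    have h2 : (n : ℝ) ^ 2 ≤ δ * (ε * (m + 1)) := by
      have : (n : ℝ) ^ 2 = δ * (ε * ((n : ℝ) ^ 2 * (1 / ε) * (1 / δ))) := by field_simp
      rw [this]
      gcongr
      linarith
    refine (le_iidProb_notMem_span_lt (φ n) D hε (le_trans ?_ h2)).trans
      (iidProb_mono D fun x hx => ?_)
    · exact_mod_cast hV n
    · obtain ⟨h, t, hc, hh⟩ := hL n f ε δ hε hδ m x
      refine ⟨h, t, hc, lt_of_le_of_lt (prob_le_prob D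
        (E' := fun S => φ n S ∉ Submodule.span ℚ (Set.range (φ n ∘ x))) fun S hS hmem => hS ?_) hx⟩
      obtain ⟨l, hl⟩ := hφ n f h
      -- The difference of target and hypothesis vanishes on the samples, hence on their span.
      have : l (φ n S) = 0 := by
        refine Submodule.span_induction (p := fun v _ => l v = 0) ?_ (map_zero l)
          (fun u v _ _ hu hv => by rw [map_add, hu, hv, add_zero])
          (fun a v _ hv => by rw [map_smul, hv, smul_zero]) hmem
        rintro _ ⟨i, rfl⟩
        rw [Function.comp_apply, hl, hh i, sub_self]
      rw [hl, sub_eq_zero] at this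
      exact_mod_cast this

end PAC

/-! ### Expressions and matrix updates -/

namespace RAM

instance : Add Expr := ⟨.bin .add⟩
instance : Sub Expr := ⟨.bin .sub⟩
instance : Mul Expr := ⟨.bin .mul⟩
instance : Div Expr := ⟨.bin .div⟩
instance : Mod Expr := ⟨.bin .mod⟩

variable {s : State} {e e₁ e₂ : Expr} {L : ℕ}

@[simp] theorem Expr.eval_add : (e₁ + e₂).eval s = e₁.eval s + e₂.eval s := rfl
@[simp] theorem Expr.eval_sub : (e₁ - e₂).eval s = e₁.eval s - e₂.eval s := rfl
@[simp] theorem Expr.eval_mul : (e₁ * e₂).eval s = e₁.eval s * e₂.eval s := rfl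
@[simp] theorem Expr.eval_div : (e₁ / e₂).eval s = e₁.eval s / e₂.eval s := rfl
@[simp] theorem Expr.eval_mod : (e₁ % e₂).eval s = e₁.eval s % e₂.eval s := rfl
@[simp] theorem Expr.eval_const (z : ℤ) : (Expr.const z).eval s = z := rfl
@[simp] theorem Expr.eval_var (x : ℕ) : (Expr.var x).eval s = s.var x := rfl
@[simp] theorem Expr.eval_read (a : ℕ) : (Expr.read a e).eval s = s.arr a (e.eval s) := rfl

/-- The truth value of an equation. -/
def eqE (e₁ e₂ : Expr) : Expr := .const 1 / ((e₁ - e₂) * (e₁ - e₂) + .const 1)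

@[simp] theorem eval_eqE : (eqE e₁ e₂).eval s = if e₁.eval s = e₂.eval s then 1 else 0 := by
  simp only [eqE, Expr.eval_add, Expr.eval_sub, Expr.eval_mul, Expr.eval_div, Expr.eval_const]
  split_ifs with h
  · simp [h]
  · have : e₁.eval s - e₂.eval s ≠ 0 := sub_ne_zero.2 h
    have : 0 < (e₁.eval s - e₂.eval s) * (e₁.eval s - e₂.eval s) :=
      mul_self_pos.2 this
    exact Int.ediv_eq_zero_of_lt (by norm_num) (by omega)

/-- The truth value of an inequality between natural numbers. -/
def ltE (e₁ e₂ : Expr) : Expr := .const 1 - .const 1 / (e₂ / (e₁ + .const 1) + .const 1)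

/-- The quotient b / (a + 1) is positive exactly when a < b. -/
theorem eval_ltE {a b : ℕ} (h₁ : e₁.eval s = a) (h₂ : e₂.eval s = b) :
    (ltE e₁ e₂).eval s = if a < b then 1 else 0 := by
  simp only [ltE, Expr.eval_add, Expr.eval_sub, Expr.eval_div, Expr.eval_const, h₁, h₂]
  split_ifs with h
  · have h1 : (1 : ℤ) ≤ (b : ℤ) / (a + 1) := (Int.le_ediv_iff_mul_le (by omega)).2 (by omega)
    rw [Int.ediv_eq_zero_of_lt (by norm_num) (by omega)]
    rfl
  · have h1 : (b : ℤ) / (a + 1) = 0 := Int.ediv_eq_zero_of_lt (by omega) (by omega)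
    rw [h1]
    rfl

/-- The row of the current matrix entry; variable `3` is the number of columns. -/
def rowE : Expr := .var 7 / .var 3

/-- The column of the current matrix entry. -/
def colE : Expr := .var 7 % .var 3

/-- The matrix entry in row `r` and column `c`. -/
def cell (a : ℕ) (r c : Expr) : Expr := .read a (r * .var 3 + c)

/-- The array `a` holds, row by row, a matrix `F` with `H` rows and `W` columns. -/
def Holds (s : State) (a H W : ℕ) (F : ℕ → ℕ → ℤ) : Prop :=
  ∀ ρ < H, ∀ γ < W, s.arr a ((ρ * W + γ : ℕ) : ℤ) = F ρ γ

theorem Holds.congr {s s' : State} {a H W : ℕ} {F : ℕ → ℕ → ℤ} (h : Holds s a H W F)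
    (e : s'.arr a = s.arr a) : Holds s' a H W F := fun ρ hρ γ hγ => by rw [e, h ρ hρ γ hγ]

theorem Holds.setVar {a H W : ℕ} {F : ℕ → ℕ → ℤ} (h : Holds s a H W F) (x : ℕ) (z : ℤ) :
    Holds (s.setVar x z) a H W F := h.congr rfl

theorem Holds.eval_cell {a H W : ℕ} {F : ℕ → ℕ → ℤ} (h : Holds s a H W F) (hW : s.var 3 = W)
    {r c : Expr} {ρ γ : ℕ} (hr : r.eval s = ρ) (hc : c.eval s = γ) (hρ : ρ < H) (hγ : γ < W) :
    (cell a r c).eval s = F ρ γ := by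
  rw [← h ρ hρ γ hγ]
  simp [cell, hr, hc, hW]

/-- Replace the matrix with `eH` rows in the array `a` by the values of `e`. -/
def upd (a : ℕ) (eH e : Expr) : Program :=
  .seq (fill 7 3 (eH * .var 3) e) (fill 7 a (eH * .var 3) (.read 3 (.var 7)))

/-- Running time of `upd`. -/
def updTime (eH e : Expr) (N : ℕ) : ℕ :=
  fillTime (eH * .var 3) e N + fillTime (eH * .var 3) (.read 3 (.var 7)) N

/-- The new entries are collected in the scratch array 3 before they are copied, so that `e` always
sees the old matrix. -/
theorem upd_runs {a H W : ℕ} {eH e : Expr} (F : ℕ → ℕ → ℤ) (ha : a ≠ 3) (hs : s.Bounded L)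
    (hW : s.var 3 = W)
    (hH : ∀ s', (∀ y ≠ 7, s'.var y = s.var y) → eH.eval s' = H)
    (he : ∀ ρ < H, ∀ γ < W, ∀ s', (∀ y ≠ 7, s'.var y = s.var y) → (∀ b ≠ 3, s'.arr b = s.arr b) →
      rowE.eval s' = ρ → colE.eval s' = γ → e.eval s' = F ρ γ)
    (hHL : bits ((H * W : ℕ) : ℤ) ≤ L) (hF : ∀ ρ < H, ∀ γ < W, bits (F ρ γ) ≤ L) :
    Runs L (upd a eH e) s (updTime eH e (H * W)) fun s' => s'.Bounded L ∧
      (∀ y ≠ 7, s'.var y = s.var y) ∧ (∀ b ≠ 3, b ≠ a → s'.arr b = s.arr b) ∧ Holds s' a H W F := by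
  have hk : ∀ k < H * W, 0 < W ∧ k / W < H ∧ k % W < W := by
    intro k hk
    have hW0 : 0 < W := Nat.pos_of_ne_zero (by rintro rfl; simp at hk)
    exact ⟨hW0, Nat.div_lt_of_lt_mul (by rwa [mul_comm]), Nat.mod_lt _ hW0⟩
  have hput : ∀ (s : State) z b f, ∀ y ≠ 7, (s.put 7 z b f).var y = s.var y := by
    intro s z b f y hy
    simp [hy]
  refine Runs.seq ((fill_runs hs (fun k => F (k / W) (k % W)) ?_ ?_ hHL ?_).imp ?_)
  · intro z f
    simp [hH _ (hput s z 3 f), hW]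
  · intro k hkN f
    obtain ⟨h1, h2, h3⟩ := hk k hkN
    refine he _ h2 _ h3 _ (hput s k 3 f) ?_ ?_ ?_
    · intro b hb
      simp [hb]
    · simp [rowE, hW]
    · simp [colE, hW]
  · intro k hkN
    obtain ⟨h1, h2, h3⟩ := hk k hkN
    exact hF _ h2 _ h3
  · rintro _ ⟨hb, f, rfl, hf⟩
    refine (fill_runs hb (fun k => F (k / W) (k % W)) ?_ ?_ hHL ?_).imp ?_
    · intro z f'
      have := hH ((s.put 7 (H * W : ℕ) 3 f).put 7 z a f') (by intro y hy; simp [hy])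
      rw [Expr.eval_mul, this]
      simp [hW]
    · intro k hkN f'
      rw [← hf k hkN]
      simp [ha.symm]
    · intro k hkN
      obtain ⟨h1, h2, h3⟩ := hk k hkN
      exact hF _ h2 _ h3
    · rintro _ ⟨hb', f', rfl, hf'⟩
      refine ⟨hb', fun y hy => by simp [hy], fun b hb3 hba => by simp [hb3, hba],
        fun ρ hρ γ hγ => ?_⟩
      have h1 : ρ * W + γ < H * W := by nlinarith
      have h2 : (ρ * W + γ) / W = ρ := by
        rw [mul_comm, Nat.mul_add_div (by omega), Nat.div_eq_of_lt hγ, add_zero]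
      have h3 : (ρ * W + γ) % W = γ := by
        rw [mul_comm, Nat.mul_add_mod, Nat.mod_eq_of_lt hγ]
      have h4 := hf' _ h1
      simp only [h2, h3] at h4
      simpa using h4

end RAM

/-! ### The learning algorithm -/

namespace Learner

open RAM Finset

/-- The variables `0, …, 3` contain the number `n` of players, the number `m` of samples, the number
`d = n * n` of unknowns, and the number `d + 2` of columns of the matrices. -/
structure Env (L n m : ℕ) (s : State) : Prop where
  bounded : s.Bounded L
  var_n : s.var 0 = n
  var_m : s.var 1 = m
  var_d : s.var 2 = (n * n : ℕ)
  var_W : s.var 3 = (n * n + 2 : ℕ)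

/-- The integers that occur fit into `L` bits. -/
structure Fits (m d : ℕ) (K : ℤ) (L : ℕ) : Prop where
  one_le : 1 ≤ K
  value : ∀ z : ℤ, |z| ≤ K + d * K * K → bits z ≤ L
  index : ∀ k ≤ (m + 2 * d + 1) * (d + 2), bits (k : ℤ) ≤ L

variable {L n m : ℕ} {s s' : State} {K : ℤ}

theorem Fits.le {d : ℕ} (h : Fits m d K L) {z : ℤ} (hz : |z| ≤ K) : bits z ≤ L := by
  have := h.one_le
  exact h.value z (hz.trans (le_add_of_nonneg_right (by positivity)))

theorem Fits.index' {d : ℕ} (h : Fits m d K L) {k : ℕ} (hk : k ≤ m + d + 2) :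
    bits (k : ℤ) ≤ L := h.index k (by nlinarith)

theorem Env.setVar (h : Env L n m s) {x : ℕ} (hx : 4 ≤ x) {z : ℤ} (hz : bits z ≤ L) :
    Env L n m (s.setVar x z) where
  bounded := h.bounded.setVar hz
  var_n := by simp [show 0 ≠ x by omega, h.var_n]
  var_m := by simp [show 1 ≠ x by omega, h.var_m]
  var_d := by rw [← h.var_d]; simp [show 2 ≠ x by omega]
  var_W := by rw [← h.var_W]; simp [show 3 ≠ x by omega]

theorem Env.congr (h : Env L n m s) (hb : s'.Bounded L) (hv : ∀ y ≠ 7, s'.var y = s.var y) :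
    Env L n m s' where
  bounded := hb
  var_n := by rw [hv 0 (by norm_num), h.var_n]
  var_m := by rw [hv 1 (by norm_num), h.var_m]
  var_d := by rw [hv 2 (by norm_num), h.var_d]
  var_W := by rw [hv 3 (by norm_num), h.var_W]

/-! #### Elimination -/

/-- Search for a pivot in row `var 8`; its column is stored in `var 9`. -/
def searchBody : Program :=
  .ite (cell 2 (.var 8) (.var 10) * cell 2 (.var 8) (.var 10)) (.assign 9 (.var 10)) .skip

def search : Program :=
  .seq (.assign 9 (.var 2 + .const 1)) (forTo 10 (.var 2) searchBody)

def searchTime (d : ℕ) : ℕ :=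
  ((Expr.var 2 + .const 1 : Expr).wt + 1) + forTime (.var 2) d
    ((cell 2 (.var 8) (.var 10) * cell 2 (.var 8) (.var 10)).wt + ((Expr.var 10).wt + 1) + 1)

/-- The initial value d + 1 points at the zero column, so a failed search shows up as a zero pivot.
Entries are squared because tests only detect positive values. -/
theorem search_runs {F : ℕ → ℕ → ℤ} {a : ℕ} (hf : Fits m (n * n) K L) (hs : Env L n m s)
    (hF : Holds s 2 (m + n * n) (n * n + 2) F) (ha : s.var 8 = a) (ham : a < m) :
    Runs L search s (searchTime (n * n)) fun s' => Env L n m s' ∧ s'.arr = s.arr ∧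
      s'.var 8 = a ∧ s'.var 4 = s.var 4 ∧ ∃ p : ℕ, s'.var 9 = p ∧
      (p < n * n ∧ F a p ≠ 0 ∨ p = n * n + 1 ∧ ∀ c < n * n, F a c = 0) := by
  set d := n * n with hd
  have hp : bits ((d + 1 : ℕ) : ℤ) ≤ L := hf.index' (by omega)
  have e1 : (Expr.var 2 + .const 1 : Expr).eval s = ((d + 1 : ℕ) : ℤ) := by simp [hs.var_d, hd]
  refine Runs.seq (Runs.assign hs.bounded ?_)
  rw [e1]
  have hs1 : Env L n m (s.setVar 9 ((d + 1 : ℕ) : ℤ)) := hs.setVar (by norm_num) hp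
  refine (Runs.forTo d (fun k s' => Env L n m s' ∧ s'.arr = s.arr ∧
      s'.var 8 = a ∧ s'.var 4 = s.var 4 ∧ s'.var 10 = k ∧ ∃ p : ℕ, s'.var 9 = p ∧
      (p < d ∧ F a p ≠ 0 ∨ p = d + 1 ∧ ∀ c < k, F a c = 0)) hs1.bounded ?_ ?_ ?_).imp ?_
  · exact ⟨hs1.setVar (by norm_num) (by simp [bits]), rfl, by simp [ha], by simp, by simp,
      d + 1, by simp, by simp⟩
  · rintro k s' hk ⟨h1, -, -, -, h2, -⟩
    exact ⟨h1.bounded, h2, h1.var_d⟩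
  · rintro k s₁ hk ⟨h1, h2, h3, h4, h5, p, h6, h7⟩
    have hcell : (cell 2 (.var 8) (.var 10)).eval s₁ = F a k :=
      (hF.congr (congrFun h2 2)).eval_cell h1.var_W h3 h5 (by omega) (by omega)
    have hk1 : bits ((k + 1 : ℕ) : ℤ) ≤ L := hf.index' (by omega)
    have hk0 : bits (k : ℤ) ≤ L := hf.index' (by omega)
    refine Runs.ite h1.bounded (fun hpos => ?_) (fun hneg => ?_)
    · refine Runs.assign h1.bounded ?_
      rw [Expr.eval_var, h5]
      have h8 := h1.setVar (x := 9) (by norm_num) hk0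
      exact ⟨h8.bounded, by simp [h5], h8.setVar (by norm_num) hk1, h2, by simp [h3], by simp [h4],
        by simp, k, by simp, .inl ⟨hk, fun h => by simp [hcell, h] at hpos⟩⟩
    · refine Runs.mono (Runs.skip ?_) (by omega) fun _ h => h
      rw [Expr.eval_mul, hcell] at hneg
      have hz : F a k = 0 := by
        by_contra h
        exact hneg (mul_self_pos.2 h)
      refine ⟨h1.bounded, h5, h1.setVar (by norm_num) hk1, h2, by simp [h3], by simp [h4],
        by simp, p, by simp [h6], h7.imp id fun h => ⟨h.1, fun c hc => ?_⟩⟩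
      rcases Nat.lt_succ_iff_lt_or_eq.1 hc with hc | rfl
      · exact h.2 c hc
      · exact hz
  · rintro s' ⟨h1, h2, h3, h4, -, h6⟩
    exact ⟨h1, h2, h3, h4, h6⟩

/-- Fraction-free elimination with the pivot in row `var 8` and column `var 9`. -/
def elimE : Expr :=
  (cell 2 (.var 8) (.var 9) * cell 2 rowE colE - cell 2 (.var 8) colE * cell 2 rowE (.var 9)) /
    .var 4

/-- The pivot is saved in variable 6: the update overwrites the matrix, while its formula still
divides by the previous pivot in variable 4. -/
def elimBody : Program :=
  .seq search (.ite (cell 2 (.var 8) (.var 9) * cell 2 (.var 8) (.var 9))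
    (.seq (.assign 6 (cell 2 (.var 8) (.var 9)))
      (.seq (upd 2 (.var 1 + .var 2) elimE) (.assign 4 (.var 6)))) .skip)

def elimination : Program := forTo 8 (.var 1) elimBody

def elimBodyTime (m d : ℕ) : ℕ :=
  searchTime d + ((cell 2 (.var 8) (.var 9) * cell 2 (.var 8) (.var 9)).wt +
    (((cell 2 (.var 8) (.var 9)).wt + 1) +
      (updTime (.var 1 + .var 2) elimE ((m + d) * (d + 2)) + ((Expr.var 6).wt + 1))) + 1)

variable {X : ℕ → ℕ → ℤ} {w : ℕ → ℤ}

/-- The matrix in array `2` is obtained from `X` by `k` steps of elimination. -/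
def Eliminated (X : ℕ → ℕ → ℤ) (w : ℕ → ℤ) (L n m k : ℕ) (s : State) : Prop :=
  Env L n m s ∧ ∃ F, Holds s 2 (m + n * n) (n * n + 2) F ∧
    Elimination.Invariant X m (n * n) w k F (s.var 4)

theorem elimBody_runs (hf : Fits m (n * n) K L) (hX : Elimination.IsSystem X m (n * n) w)
    (hK : ∀ k F D, k ≤ m → Elimination.Invariant X m (n * n) w k F D →
      |D| ≤ K ∧ ∀ ρ γ, |F ρ γ| ≤ K) {a : ℕ} (ham : a < m)
    (hs : Eliminated X w L n m a s) (ha : s.var 8 = a) :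
    Runs L elimBody s (elimBodyTime m (n * n)) fun s' =>
      Eliminated X w L n m (a + 1) s' ∧ s'.var 8 = a := by
  obtain ⟨hs, F, hF, hI⟩ := hs
  have hFK := (hK _ _ _ ham.le hI).2
  refine Runs.seq ((search_runs hf hs hF ha ham).imp ?_)
  rintro s₁ ⟨h1, h2, h3, h4, p, h5, h6⟩
  have hF₁ : Holds s₁ 2 (m + n * n) (n * n + 2) F := hF.congr (congrFun h2 2)
  have hpW : p < n * n + 2 := by omega
  have hcell : (cell 2 (.var 8) (.var 9)).eval s₁ = F a p :=
    hF₁.eval_cell h1.var_W h3 h5 (by omega) hpW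
  refine Runs.ite h1.bounded (fun hpos => ?_) (fun hneg => ?_)
  · rw [Expr.eval_mul, hcell] at hpos
    have hp : F a p ≠ 0 := by
      rintro h
      simp [h] at hpos
    have hpd : p < n * n := by
      rcases h6 with h | ⟨rfl, -⟩
      · exact h.1
      · exact absurd (hI.zero_col a) hp
    have hI' := hI.elim hX ham hpd hp
    refine Runs.seq (Runs.assign h1.bounded ?_)
    rw [hcell]
    have h1' : Env L n m (s₁.setVar 6 (F a p)) := h1.setVar (by norm_num) (hf.le (hFK a p))
    refine Runs.seq ((upd_runs (Elimination.elim F (s.var 4) a p) (by norm_num) h1'.bounded h1'.var_W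
      (H := m + n * n) ?_ ?_ ?_ ?_).imp ?_)
    · intro s' hv
      simp [hv, h1.var_m, h1.var_d]
    · intro ρ hρ γ hγ s' hv hb hr hc
      have hW : s'.var 3 = (n * n + 2 : ℕ) := by rw [hv 3 (by norm_num), h1'.var_W]
      have h8 : (Expr.var 8).eval s' = a := by simp [hv, h3]
      have h9 : (Expr.var 9).eval s' = p := by simp [hv, h5]
      have hF' : Holds s' 2 (m + n * n) (n * n + 2) F := hF₁.congr (hb 2 (by norm_num))
      rw [elimE, Expr.eval_div, Expr.eval_sub, Expr.eval_mul, Expr.eval_mul,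
        hF'.eval_cell hW h8 h9 (by omega) hpW, hF'.eval_cell hW hr hc hρ hγ,
        hF'.eval_cell hW h8 hc (by omega) hγ, hF'.eval_cell hW hr h9 hρ hpW]
      simp [hv, h4, Elimination.elim]
    · exact hf.index _ (Nat.mul_le_mul_right _ (by omega))
    · intro ρ _ γ _
      exact hf.le ((hK _ _ _ ham hI').2 ρ γ)
    · rintro s₂ ⟨hb, hv, -, hH⟩
      refine Runs.assign hb ?_
      have h6' : (Expr.var 6).eval s₂ = F a p := by simp [hv]
      rw [h6']
      refine ⟨⟨(h1'.congr hb hv).setVar (by norm_num) (hf.le (hFK a p)),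
        Elimination.elim F (s.var 4) a p, hH.setVar _ _, by simpa using hI'⟩, ?_⟩
      simp [hv, h3]
  · refine Runs.mono (Runs.skip ?_) (by omega) fun _ h => h
    rw [Expr.eval_mul, hcell] at hneg
    have hz : F a p = 0 := by
      by_contra h
      exact hneg (mul_self_pos.2 h)
    refine ⟨⟨h1, F, hF₁, ?_⟩, h3⟩
    rw [h4]
    rcases h6 with h | ⟨-, h⟩
    · exact absurd hz h.2
    · exact hI.skip hX ham h

theorem elimination_runs (hf : Fits m (n * n) K L) (hX : Elimination.IsSystem X m (n * n) w)
    (hK : ∀ k F D, k ≤ m → Elimination.Invariant X m (n * n) w k F D →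
      |D| ≤ K ∧ ∀ ρ γ, |F ρ γ| ≤ K) (hs : Eliminated X w L n m 0 s) :
    Runs L elimination s (forTime (.var 1) m (elimBodyTime m (n * n)))
      (Eliminated X w L n m m) := by
  have hset : ∀ k s z, bits z ≤ L → Eliminated X w L n m k s →
      Eliminated X w L n m k (s.setVar 8 z) := by
    rintro k s z hz ⟨h, F, hF, hI⟩
    exact ⟨h.setVar (by norm_num) hz, F, hF.setVar _ _, by simpa using hI⟩
  refine (Runs.forTo m (fun k s' => Eliminated X w L n m k s' ∧ s'.var 8 = k)
    hs.1.bounded ?_ ?_ ?_).imp fun _ h => h.1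
  · exact ⟨hset _ _ _ (by simp [bits]) hs, by simp⟩
  · rintro k s' hk ⟨h1, h2⟩
    exact ⟨h1.1.bounded, h2, h1.1.var_m⟩
  · rintro k s' hk ⟨h1, h2⟩
    refine (elimBody_runs hf hX hK hk h1 h2).imp ?_
    rintro s'' ⟨h3, h4⟩
    exact ⟨h3.1.bounded, h4, hset _ _ _ (hf.index' (by omega)) h3, by simp⟩

end Learner

namespace Learner

open RAM Finset

variable {L n m : ℕ} {s s' : State} {K : ℤ} {F G : ℕ → ℕ → ℤ} {D E : ℤ}

/-! #### Congruences -/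

/-- The memory while the congruences are solved. -/
structure Memory (L n m : ℕ) (F : ℕ → ℕ → ℤ) (D E : ℤ) (G : ℕ → ℕ → ℤ) (s : State) : Prop where
  env : Env L n m s
  holdsF : Holds s 2 (m + n * n) (n * n + 2) F
  var_D : s.var 4 = D
  var_E : s.var 5 = E
  holdsG : Holds s 4 (n * n + n * n) (n * n + 2) G

theorem Memory.setVar (h : Memory L n m F D E G s) {x : ℕ} (hx : 6 ≤ x) {z : ℤ} (hz : bits z ≤ L) :
    Memory L n m F D E G (s.setVar x z) where
  env := h.env.setVar (by omega) hz
  holdsF := h.holdsF.setVar _ _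
  var_D := by simp [show 4 ≠ x by omega, h.var_D]
  var_E := by simp [show 5 ≠ x by omega, h.var_E]
  holdsG := h.holdsG.setVar _ _

/-- Updating the matrix in array `4`. -/
theorem Memory.upd_runs (h : Memory L n m F D E G s) (hf : Fits m (n * n) K L) {e : Expr}
    (G' : ℕ → ℕ → ℤ) (hE : E ≤ K) (h0 : ∀ ρ γ, 0 ≤ G' ρ γ) (h1 : ∀ ρ γ, G' ρ γ ≤ E)
    (he : ∀ ρ < n * n + n * n, ∀ γ < n * n + 2, ∀ s', (∀ y ≠ 7, s'.var y = s.var y) →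
      s'.var 2 = ((n * n : ℕ) : ℤ) → s'.var 3 = ((n * n + 2 : ℕ) : ℤ) → s'.var 5 = E →
      Holds s' 4 (n * n + n * n) (n * n + 2) G →
      rowE.eval s' = ρ → colE.eval s' = γ → e.eval s' = G' ρ γ) :
    Runs L (upd 4 (.var 2 + .var 2) e) s (updTime (.var 2 + .var 2) e ((n * n + n * n) * (n * n + 2)))
      fun s' => Memory L n m F D E G' s' ∧ ∀ y ≠ 7, s'.var y = s.var y := by
  refine (RAM.upd_runs G' (H := n * n + n * n) (by norm_num) h.env.bounded h.env.var_W
    ?_ ?_ ?_ ?_).imp ?_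
  · intro s' hv
    simp [hv, h.env.var_d]
  · intro ρ hρ γ hγ s' hv hb hr hc
    exact he ρ hρ γ hγ s' hv (by rw [hv 2 (by norm_num), h.env.var_d])
      (by rw [hv 3 (by norm_num), h.env.var_W]) (by rw [hv 5 (by norm_num), h.var_E])
      (h.holdsG.congr (hb 4 (by norm_num))) hr hc
  · exact hf.index _ (Nat.mul_le_mul_right _ (by omega))
  · intro ρ _ γ _
    exact hf.le (by rw [abs_of_nonneg (h0 ρ γ)]; exact (h1 ρ γ).trans hE)
  · rintro s₁ ⟨hb, hv, ha, hG⟩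
    exact ⟨⟨h.env.congr hb hv, h.holdsF.congr (ha 2 (by norm_num) (by norm_num)),
      by rw [hv 4 (by norm_num), h.var_D], by rw [hv 5 (by norm_num), h.var_E], hG⟩, hv⟩

/-- The column `d + 1`. -/
def slotE : Expr := .var 2 + .const 1

theorem eval_slotE (h : s.var 2 = ((n * n : ℕ) : ℤ)) : slotE.eval s = ((n * n + 1 : ℕ) : ℤ) := by
  simp [slotE, h]

/-- Case distinctions become arithmetic: truth values 0 and 1 serve as coefficients of the
alternatives. -/
def resetE : Expr :=
  (.const 1 - eqE colE slotE) * cell 4 rowE colE + eqE colE slotE * eqE rowE (.var 11) * .var 5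

def euclidE : Expr :=
  eqE colE slotE * cell 4 rowE (.var 12) + (.const 1 - eqE colE slotE) *
    (eqE colE (.var 12) * ((cell 4 rowE slotE - .var 6 * cell 4 rowE (.var 12)) % .var 5) +
      (.const 1 - eqE colE (.var 12)) * cell 4 rowE colE)

def reduceE : Expr :=
  eqE colE (.var 2) * ((cell 4 rowE (.var 2) - .var 6 * cell 4 rowE slotE) % .var 5) +
    (.const 1 - eqE colE (.var 2)) * cell 4 rowE colE

def euclidBody : Program :=
  .seq (.assign 6 (cell 4 (.var 11) slotE / cell 4 (.var 11) (.var 12)))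
    (upd 4 (.var 2 + .var 2) euclidE)

def congruenceBody : Program :=
  .seq (upd 4 (.var 2 + .var 2) resetE)
    (.seq (forTo 12 (.var 2) (.while (cell 4 (.var 11) (.var 12)) euclidBody))
      (.seq (.assign 6 (cell 4 (.var 11) (.var 2) / cell 4 (.var 11) slotE))
        (upd 4 (.var 2 + .var 2) reduceE)))

def congruences : Program := forTo 11 (.var 2) congruenceBody

def euclidBodyTime (d : ℕ) : ℕ :=
  ((cell 4 (.var 11) slotE / cell 4 (.var 11) (.var 12)).wt + 1) +
    updTime (.var 2 + .var 2) euclidE ((d + d) * (d + 2))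

/-- The measure is at most 2 L + 1, namely two bit lengths and the order flag; one further test ends
the loop. -/
def euclidTime (d L : ℕ) : ℕ :=
  (2 * L + 2) * (euclidBodyTime d + (cell 4 (.var 11) (.var 12)).wt + 1)

def congruenceBodyTime (d L : ℕ) : ℕ :=
  updTime (.var 2 + .var 2) resetE ((d + d) * (d + 2)) +
    (forTime (.var 2) d (euclidTime d L) +
      (((cell 4 (.var 11) (.var 2) / cell 4 (.var 11) slotE).wt + 1) +
        updTime (.var 2 + .var 2) reduceE ((d + d) * (d + 2))))

variable {M : ℕ → ℕ → ℤ} {y : ℕ → ℤ}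

/-- A quotient of entries of `G` fits into the memory. -/
theorem bits_div_le (hf : Fits m (n * n) K L) (hE : E ≤ K) {a b : ℤ} (h0 : 0 ≤ a) (h1 : a ≤ E) :
    bits (a / b) ≤ L :=
  (bits_mono (Int.natAbs_ediv_le_natAbs a b)).trans
    (hf.le (by rw [abs_of_nonneg h0]; exact h1.trans hE))

theorem euclid_runs (hf : Fits m (n * n) K L) (hE0 : 0 < E) (hE : E ≤ K) {i j : ℕ}
    (hi : i < n * n) (hj : j < n * n) (h : Memory L n m F D E G s)
    (hG : Congruence.Inner M y (n * n) E i j G) (hsi : s.var 11 = i) (hsj : s.var 12 = j) :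
    Runs L (.while (cell 4 (.var 11) (.var 12)) euclidBody) s (euclidTime (n * n) L) fun s' =>
      (∃ G', Memory L n m F D E G' s' ∧ Congruence.Inner M y (n * n) E i (j + 1) G') ∧
      s'.var 11 = i ∧ s'.var 12 = j := by
  have hcell : ∀ G s, Memory L n m F D E G s → s.var 11 = i → s.var 12 = j →
      (cell 4 (.var 11) (.var 12)).eval s = G i j := fun G s h hsi hsj =>
    h.holdsG.eval_cell h.env.var_W hsi hsj (by omega) (by omega)
  have hslot : ∀ G s, Memory L n m F D E G s → s.var 11 = i →
      (cell 4 (.var 11) slotE).eval s = G i (n * n + 1) := fun G s h hsi =>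
    h.holdsG.eval_cell h.env.var_W hsi (eval_slotE h.env.var_d) (by omega) (by omega)
  refine (Runs.while (T := euclidBodyTime (n * n)) (fun k s => ∃ G, Memory L n m F D E G s ∧
    Congruence.Inner M y (n * n) E i j G ∧ s.var 11 = i ∧ s.var 12 = j ∧
    Congruence.measure (G i (n * n + 1)) (G i j) = k) ?_ ?_ ?_ _ s ⟨G, h, hG, hsi, hsj, rfl⟩).mono
    ?_ fun _ h => h
  · rintro k s ⟨G, h, -⟩
    exact h.env.bounded
  · rintro k s ⟨G, h, hG, hsi, hsj, rfl⟩ hpos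
    rw [hcell G s h hsi hsj] at hpos
    have hG' := hG.euclid hE0 hj hpos
    refine Runs.seq (Runs.assign h.env.bounded ?_)
    rw [Expr.eval_div, hcell G s h hsi hsj, hslot G s h hsi]
    have h1 := h.setVar (x := 6) le_rfl
      (bits_div_le hf hE (b := G i j) (hG.nonneg i (n * n + 1)) (hG.le _ _))
    refine (h1.upd_runs hf (Congruence.euclid (n * n) E i j G) hE hG'.nonneg hG'.le ?_).imp ?_
    · intro ρ hρ γ hγ s' hv h2 h3 h5 hh hr hc
      have h12 : (Expr.var 12).eval s' = j := by simp [hv, hsj]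
      have hq : s'.var 6 = G i (n * n + 1) / G i j := by simp [hv]
      have hsl := eval_slotE h2
      simp only [euclidE, Expr.eval_add, Expr.eval_sub, Expr.eval_mul, Expr.eval_mod, eval_eqE,
        Expr.eval_const, hh.eval_cell h3 hr hc hρ hγ, hh.eval_cell h3 hr h12 hρ (by omega),
        hh.eval_cell h3 hr hsl hρ (by omega), hsl, hc, h12]
      simp only [Expr.eval_var, hq, h5, Congruence.euclid, Nat.cast_inj]
      split_ifs <;> simp
    · rintro s₁ ⟨h2, hv⟩
      exact ⟨_, hG.measure_lt hj hpos, _, h2, hG', by simp [hv, hsi], by simp [hv, hsj], rfl⟩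
  · rintro k s ⟨G, h, hG, hsi, hsj, -⟩ hneg
    rw [hcell G s h hsi hsj] at hneg
    exact ⟨⟨G, h, hG.next hneg⟩, hsi, hsj⟩
  · have hsize : ∀ γ, (G i γ).natAbs.size ≤ L := fun γ =>
      hf.le (by rw [abs_of_nonneg (hG.nonneg _ _)]; exact (hG.le _ _).trans hE)
    have h1 := hsize (n * n + 1)
    have h2 := hsize j
    refine Nat.mul_le_mul_right _ ?_
    unfold Congruence.measure
    split_ifs <;> omega

theorem congruenceBody_runs (hf : Fits m (n * n) K L) (hE0 : 0 < E) (hE : E ≤ K) {i : ℕ}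
    (hi : i < n * n) (h : Memory L n m F D E G s) (hG : Congruence.Outer M y (n * n) E i G)
    (hsi : s.var 11 = i) :
    Runs L congruenceBody s (congruenceBodyTime (n * n) L) fun s' =>
      (∃ G', Memory L n m F D E G' s' ∧ Congruence.Outer M y (n * n) E (i + 1) G') ∧
      s'.var 11 = i := by
  have hG₁ := hG.inner hE0 hi
  refine Runs.seq ((h.upd_runs hf (Congruence.reset (n * n) E i G) hE hG₁.nonneg hG₁.le ?_).imp ?_)
  · intro ρ hρ γ hγ s' hv h2 h3 h5 hh hr hc
    have h11 : (Expr.var 11).eval s' = i := by simp [hv, hsi]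
    have hsl := eval_slotE h2
    simp only [resetE, Expr.eval_add, Expr.eval_sub, Expr.eval_mul, eval_eqE,
      Expr.eval_const, hh.eval_cell h3 hr hc hρ hγ, hsl, hc, hr, h11]
    simp only [Expr.eval_var, h5, Congruence.reset, Nat.cast_inj]
    split_ifs <;> simp
  rintro s₁ ⟨h1, hv1⟩
  have hs1 : s₁.var 11 = i := by rw [hv1 11 (by norm_num), hsi]
  refine Runs.seq ((Runs.forTo (n * n) (fun j s => (∃ G, Memory L n m F D E G s ∧
    Congruence.Inner M y (n * n) E i j G) ∧ s.var 11 = i ∧ s.var 12 = j)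
    h1.env.bounded ?_ ?_ ?_).imp ?_)
  · exact ⟨⟨_, h1.setVar (by norm_num) (by simp [bits]), hG₁⟩, by simp [hs1], by simp⟩
  · rintro k s hk ⟨⟨G, h, -⟩, -, h12⟩
    exact ⟨h.env.bounded, h12, h.env.var_d⟩
  · rintro k s hk ⟨⟨G, h, hG⟩, h11, h12⟩
    refine (euclid_runs hf hE0 hE hi hk h hG h11 h12).imp ?_
    rintro s' ⟨⟨G', h', hG'⟩, h11', h12'⟩
    exact ⟨h'.env.bounded, h12', ⟨G', h'.setVar (by norm_num) (hf.index' (by omega)), hG'⟩,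
      by simp [h11'], by simp⟩
  rintro s₂ ⟨⟨G₂, h2, hG2⟩, hs2, -⟩
  have hG3 := hG2.reduce hE0 hi
  have hcd : (cell 4 (.var 11) (.var 2)).eval s₂ = G₂ i (n * n) :=
    h2.holdsG.eval_cell h2.env.var_W hs2 h2.env.var_d (by omega) (by omega)
  have hcs : (cell 4 (.var 11) slotE).eval s₂ = G₂ i (n * n + 1) :=
    h2.holdsG.eval_cell h2.env.var_W hs2 (eval_slotE h2.env.var_d) (by omega) (by omega)
  refine Runs.seq (Runs.assign h2.env.bounded ?_)
  rw [Expr.eval_div, hcd, hcs]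
  have h2' := h2.setVar (x := 6) le_rfl
    (bits_div_le hf hE (b := G₂ i (n * n + 1)) (hG2.nonneg i (n * n)) (hG2.le _ _))
  refine (h2'.upd_runs hf (Congruence.reduce (n * n) E i G₂) hE hG3.nonneg hG3.le ?_).imp ?_
  · intro ρ hρ γ hγ s' hv h2 h3 h5 hh hr hc
    have h2e : (Expr.var 2).eval s' = ((n * n : ℕ) : ℤ) := h2
    have hq : s'.var 6 = G₂ i (n * n) / G₂ i (n * n + 1) := by simp [hv]
    have hsl := eval_slotE h2
    simp only [reduceE, Expr.eval_add, Expr.eval_sub, Expr.eval_mul, Expr.eval_mod, eval_eqE,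
      Expr.eval_const, hh.eval_cell h3 hr hc hρ hγ, hh.eval_cell h3 hr h2e hρ (by omega),
      hh.eval_cell h3 hr hsl hρ (by omega), hc]
    simp only [Expr.eval_var, hq, h5, h2, Congruence.reduce, Nat.cast_inj]
    split_ifs <;> simp
  · rintro s₃ ⟨h3, hv⟩
    exact ⟨⟨_, h3, hG3⟩, by simp [hv, hs2]⟩

theorem congruences_runs (hf : Fits m (n * n) K L) (hE0 : 0 < E) (hE : E ≤ K)
    (h : Memory L n m F D E G s) (hG : Congruence.Outer M y (n * n) E 0 G) :
    Runs L congruences s (forTime (.var 2) (n * n) (congruenceBodyTime (n * n) L)) fun s' =>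
      ∃ G', Memory L n m F D E G' s' ∧ Congruence.Outer M y (n * n) E (n * n) G' := by
  refine (Runs.forTo (n * n) (fun i s => (∃ G, Memory L n m F D E G s ∧
    Congruence.Outer M y (n * n) E i G) ∧ s.var 11 = i) h.env.bounded ?_ ?_ ?_).imp fun _ h => h.1
  · exact ⟨⟨_, h.setVar (by norm_num) (by simp [bits]), hG⟩, by simp⟩
  · rintro k s hk ⟨⟨G, h, -⟩, h11⟩
    exact ⟨h.env.bounded, h11, h.env.var_d⟩
  · rintro k s hk ⟨⟨G, h, hG⟩, h11⟩
    refine (congruenceBody_runs hf hE0 hE hk h hG h11).imp ?_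
    rintro s' ⟨⟨G', h', hG'⟩, h11'⟩
    exact ⟨h'.env.bounded, h11', ⟨G', h'.setVar (by norm_num) (hf.index' (by omega)), hG'⟩, by simp⟩

/-- The initial matrix of the congruences. -/
def startE : Expr :=
  ltE rowE (.var 2) * (cell 2 (.var 1 + rowE) colE % .var 5) +
    (.const 1 - ltE rowE (.var 2)) * eqE (rowE - .var 2) colE

/-- The modulus is |D|, as D may be negative and the remainders must be bounded by a positive
modulus. -/
def startCongruences : Program :=
  .seq (.ite (.var 4) (.assign 5 (.var 4)) (.assign 5 (.const 0 - .var 4)))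
    (upd 4 (.var 2 + .var 2) startE)

def startTime (d : ℕ) : ℕ :=
  ((Expr.var 4).wt + (((Expr.var 4).wt + 1) + ((.const 0 - .var 4 : Expr).wt + 1)) + 1) +
    updTime (.var 2 + .var 2) startE ((d + d) * (d + 2))

theorem startCongruences_runs (hf : Fits m (n * n) K L) (hs : Env L n m s)
    (hF : Holds s 2 (m + n * n) (n * n + 2) F) (hD : s.var 4 ≠ 0) (hDK : |s.var 4| ≤ K) :
    Runs L startCongruences s (startTime (n * n)) (Memory L n m F (s.var 4) |s.var 4|
      (Congruence.start (fun ρ => F (m + ρ)) (n * n) |s.var 4|)) := by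
  have hb : bits |s.var 4| ≤ L := hf.le (by rwa [abs_abs])
  have hE0 : 0 < |s.var 4| := abs_pos.2 hD
  refine Runs.seq (T₁ := (Expr.var 4).wt + _ + 1) (Runs.mono (Q := fun s' => s' = s.setVar 5 |s.var 4|)
    (Runs.ite (T := ((Expr.var 4).wt + 1) + ((.const 0 - .var 4 : Expr).wt + 1))
      hs.bounded (fun h => ?_) (fun h => ?_)) le_rfl ?_)
  · refine (Runs.assign hs.bounded ?_).mono (Nat.le_add_right _ _) fun _ h => h
    rw [Expr.eval_var] at h ⊢
    rw [abs_of_pos h]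
  · refine (Runs.assign hs.bounded ?_).mono (Nat.le_add_left _ _) fun _ h => h
    rw [Expr.eval_var] at h
    rw [Expr.eval_sub, Expr.eval_var, Expr.eval_const, zero_sub, abs_of_nonpos (not_lt.1 h)]
  rintro _ rfl
  have h1 := hs.setVar (x := 5) (by norm_num) hb
  refine (upd_runs (Congruence.start (fun ρ => F (m + ρ)) (n * n) |s.var 4|) (H := n * n + n * n)
    (by norm_num) h1.bounded h1.var_W ?_ ?_ ?_ ?_).imp ?_
  · intro s' hv
    simp [hv, hs.var_d]
  · intro ρ hρ γ hγ s' hv ha hr hc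
    have h2 : (Expr.var 2).eval s' = (n * n : ℕ) := by rw [Expr.eval_var, hv 2 (by norm_num), h1.var_d]
    have h3 : s'.var 3 = (n * n + 2 : ℕ) := by rw [hv 3 (by norm_num), h1.var_W]
    have h5 : s'.var 5 = |s.var 4| := by simp [hv]
    have hr' : (Expr.var 1 + rowE).eval s' = (m + ρ : ℕ) := by
      simp [hv, hr, hs.var_m]
    rw [startE, Expr.eval_add, Expr.eval_mul, Expr.eval_mul, Expr.eval_sub, eval_ltE hr h2, eval_eqE,
      Expr.eval_sub, hr, hc, h2, Expr.eval_mod, Expr.eval_var, h5, Congruence.start]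
    split_ifs with h6 h7 h8 h8
    · rw [(hF.congr (ha 2 (by norm_num))).eval_cell h3 hr' hc (by omega) hγ]
      simp
    · rw [(hF.congr (ha 2 (by norm_num))).eval_cell h3 hr' hc (by omega) hγ]
      simp
    · simp
    · omega
    · omega
    · simp
  · exact hf.index _ (Nat.mul_le_mul_right _ (by omega))
  · intro ρ _ γ _
    refine hf.le ?_
    have h6 : 0 ≤ Congruence.start (fun ρ => F (m + ρ)) (n * n) |s.var 4| ρ γ ∧
        Congruence.start (fun ρ => F (m + ρ)) (n * n) |s.var 4| ρ γ ≤ |s.var 4| := by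
      unfold Congruence.start
      split_ifs
      · exact ⟨Int.emod_nonneg _ hE0.ne', (Int.emod_lt_of_pos _ hE0).le⟩
      · exact ⟨zero_le_one, hE0⟩
      · exact ⟨le_rfl, hE0.le⟩
    rw [abs_of_nonneg h6.1]
    exact h6.2.trans hDK
  · rintro s₁ ⟨hb', hv, ha, hG⟩
    exact ⟨h1.congr hb' hv, hF.congr (ha 2 (by norm_num) (by norm_num)), by simp [hv], by simp [hv], hG⟩

end Learner

namespace Learner

open RAM Finset

variable {L n m : ℕ} {s s' : State} {K : ℤ} {F G : ℕ → ℕ → ℤ} {D E : ℤ}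

/-! #### The integral solution -/

/-- Add `var 12`-th column, multiplied by the solution of the congruences, to the column `d`. -/
def accE : Expr :=
  cell 2 rowE colE + eqE colE (.var 2) *
    (cell 2 rowE (.var 12) * cell 4 (.var 2 + .var 12) (.var 2))

def accumulate : Program := forTo 12 (.var 2) (upd 2 (.var 1 + .var 2) accE)

/-- The matrix `F` after `k` columns, multiplied by `t`, have been added to the column `d`. -/
def acc (F : ℕ → ℕ → ℤ) (t : ℕ → ℤ) (d k ρ γ : ℕ) : ℤ :=
  F ρ γ + if γ = d then ∑ j ∈ range k, F ρ j * t j else 0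

/-- These are the largest integers that are stored; they dictate the bound in `Fits`. -/
theorem abs_acc_le {t : ℕ → ℤ} {d k : ℕ} (hk : k ≤ d) (hF : ∀ ρ γ, |F ρ γ| ≤ K)
    (ht : ∀ j, |t j| ≤ K) (ρ γ : ℕ) : |acc F t d k ρ γ| ≤ K + d * K * K := by
  have hK : 0 ≤ K := (abs_nonneg _).trans (ht 0)
  unfold acc
  refine (abs_add_le _ _).trans (add_le_add (hF ρ γ) ?_)
  split_ifs
  · calc |∑ j ∈ range k, F ρ j * t j| ≤ ∑ j ∈ range k, |F ρ j * t j| := abs_sum_le_sum_abs _ _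
      _ ≤ ∑ j ∈ range k, K * K := sum_le_sum fun j _ => by
          rw [abs_mul]
          exact mul_le_mul (hF ρ j) (ht j) (abs_nonneg _) hK
      _ = k * K * K := by simp [mul_assoc]
      _ ≤ d * K * K := by gcongr
  · simp only [abs_zero]
    positivity

theorem accumulate_runs (hf : Fits m (n * n) K L) (h : Memory L n m F D E G s)
    (hF : ∀ ρ γ, |F ρ γ| ≤ K) (hG : ∀ ρ γ, |G ρ γ| ≤ K) :
    Runs L accumulate s (forTime (.var 2) (n * n)
      (updTime (.var 1 + .var 2) accE ((m + n * n) * (n * n + 2)))) (Memory L n m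
        (acc F (fun j => G (n * n + j) (n * n)) (n * n) (n * n)) D E G) := by
  set t : ℕ → ℤ := fun j => G (n * n + j) (n * n) with ht
  have ht' : ∀ j, |t j| ≤ K := fun j => hG _ _
  refine (Runs.forTo (n * n) (fun k s => Memory L n m (acc F t (n * n) k) D E G s ∧ s.var 12 = k)
    h.env.bounded ?_ ?_ ?_).imp fun _ h => h.1
  · refine ⟨?_, by simp⟩
    have : acc F t (n * n) 0 = F := by
      ext ρ γ
      simp [acc]
    rw [this]
    exact h.setVar (by norm_num) (by simp [bits])
  · rintro k s hk ⟨h, h12⟩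
    exact ⟨h.env.bounded, h12, h.env.var_d⟩
  · rintro k s hk ⟨h, h12⟩
    refine (upd_runs (acc F t (n * n) (k + 1)) (H := m + n * n) (by norm_num) h.env.bounded
      h.env.var_W ?_ ?_ ?_ ?_).imp ?_
    · intro s' hv
      simp [hv, h.env.var_m, h.env.var_d]
    · intro ρ hρ γ hγ s' hv ha hr hc
      have h2 : (Expr.var 2).eval s' = ((n * n : ℕ) : ℤ) := by
        rw [Expr.eval_var, hv 2 (by norm_num), h.env.var_d]
      have h3 : s'.var 3 = ((n * n + 2 : ℕ) : ℤ) := by rw [hv 3 (by norm_num), h.env.var_W]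
      have h12' : (Expr.var 12).eval s' = k := by rw [Expr.eval_var, hv 12 (by norm_num), h12]
      have hk' : (Expr.var 2 + .var 12).eval s' = ((n * n + k : ℕ) : ℤ) := by
        rw [Expr.eval_add, h2, h12']
        push_cast
        rfl
      have hF' := h.holdsF.congr (ha 2 (by norm_num))
      have hG' := h.holdsG.congr (ha 4 (by norm_num))
      rw [accE, Expr.eval_add, Expr.eval_mul, Expr.eval_mul, hF'.eval_cell h3 hr hc hρ hγ,
        hF'.eval_cell h3 hr h12' hρ (by omega), hG'.eval_cell h3 hk' h2 (by omega) (by omega),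
        eval_eqE, hc, h2]
      -- Only column `d` accumulates, so column `k` still holds its original entries.
      simp only [acc, Nat.cast_inj, hk.ne, if_false, add_zero, sum_range_succ, ht]
      split_ifs <;> ring
    · exact hf.index _ (Nat.mul_le_mul_right _ (by omega))
    · intro ρ _ γ _
      exact hf.value _ (abs_acc_le (by omega) hF ht' ρ γ)
    · rintro s₁ ⟨hb, hv, ha, hF'⟩
      have h1 : Memory L n m (acc F t (n * n) (k + 1)) D E G s₁ :=
        ⟨h.env.congr hb hv, hF', by rw [hv 4 (by norm_num), h.var_D],
          by rw [hv 5 (by norm_num), h.var_E], h.holdsG.congr (ha 4 (by norm_num) (by norm_num))⟩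
      exact ⟨hb, by rw [hv 12 (by norm_num), h12],
        h1.setVar (by norm_num) (hf.index' (by omega)), by simp⟩

/-! #### Output -/

/-- The weight matrix with the entries `u (i * n + j)` for `i < j`. -/
def weight (u : ℕ → ℤ) (n i j : ℕ) : ℤ :=
  if i < j then u (i * n + j) else if j < i then u (j * n + i) else 0

def outI : Expr := (.var 7 - .const 1) / .var 0

def outJ : Expr := (.var 7 - .const 1) % .var 0

/-- The solution at the index `i * n + j`. -/
def entryE (i j : Expr) : Expr := cell 2 (.var 1 + (i * .var 0 + j)) (.var 2) / .var 4

def outputE : Expr :=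
  eqE (.var 7) (.const 0) * .var 2 + (.const 1 - eqE (.var 7) (.const 0)) *
    (ltE outI outJ * entryE outI outJ + ltE outJ outI * entryE outJ outI)

def output : Program := fill 7 1 (.var 2 + .const 1) outputE

theorem output_runs (hf : Fits m (n * n) K L) (h : Memory L n m F D E G s) {u : ℕ → ℤ}
    (hF : ∀ ρ γ, |F ρ γ| ≤ K + (n * n : ℕ) * K * K)
    (hu : ∀ k, k < n * n → F (m + k) (n * n) / D = u k) :
    Runs L output s (fillTime (.var 2 + .const 1) outputE (n * n + 1)) fun s' =>
      s'.arr 1 0 = (n * n : ℕ) ∧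
      ∀ k < n * n, s'.arr 1 ((k : ℤ) + 1) = weight u n (k / n) (k % n) := by
  have hub : ∀ k < n * n, bits (u k) ≤ L := fun k hk => by
    rw [← hu k hk]
    exact (bits_mono (Int.natAbs_ediv_le_natAbs _ _)).trans (hf.value _ (hF _ _))
  have hidx : ∀ k < n * n, 0 < n ∧ k / n < n ∧ k % n < n := by
    intro k hk
    have hn : 0 < n := Nat.pos_of_ne_zero (by rintro rfl; simp at hk)
    exact ⟨hn, Nat.div_lt_of_lt_mul hk, Nat.mod_lt _ hn⟩
  have hlt : ∀ i < n, ∀ j < n, i * n + j < n * n := fun i hi j hj => by nlinarith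
  refine (fill_runs h.env.bounded
    (fun k => if k = 0 then ((n * n : ℕ) : ℤ) else weight u n ((k - 1) / n) ((k - 1) % n))
    ?_ ?_ (hf.index' (by omega)) ?_).imp ?_
  · intro z f
    simp [h.env.var_d]
  · intro k hk f
    have h0 : (s.put 7 k 1 f).var 0 = n := by simp [h.env.var_n]
    have h1 : (s.put 7 k 1 f).var 1 = m := by simp [h.env.var_m]
    have h2 : (Expr.var 2).eval (s.put 7 k 1 f) = ((n * n : ℕ) : ℤ) := by simp [h.env.var_d]
    have h3 : (s.put 7 k 1 f).var 3 = ((n * n + 2 : ℕ) : ℤ) := by simp [h.env.var_W]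
    have h4 : (s.put 7 k 1 f).var 4 = D := by simp [h.var_D]
    have h7 : (s.put 7 k 1 f).var 7 = k := by simp
    have hF' : Holds (s.put 7 k 1 f) 2 (m + n * n) (n * n + 2) F := h.holdsF.congr (by simp)
    rw [outputE, Expr.eval_add, Expr.eval_mul, Expr.eval_mul, Expr.eval_sub, eval_eqE, h2,
      Expr.eval_var, h7, Expr.eval_const, Expr.eval_const]
    rcases Nat.eq_zero_or_pos k with rfl | hk0
    · simp
    · obtain ⟨k, rfl⟩ : ∃ k', k = k' + 1 := ⟨k - 1, by omega⟩
      obtain ⟨hn, hi, hj⟩ := hidx k (by omega)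
      have hI : outI.eval (s.put 7 ((k + 1 : ℕ) : ℤ) 1 f) = ((k / n : ℕ) : ℤ) := by
        rw [outI, Expr.eval_div, Expr.eval_sub, Expr.eval_var, Expr.eval_var, h7, h0]
        simp
      have hJ : outJ.eval (s.put 7 ((k + 1 : ℕ) : ℤ) 1 f) = ((k % n : ℕ) : ℤ) := by
        rw [outJ, Expr.eval_mod, Expr.eval_sub, Expr.eval_var, Expr.eval_var, h7, h0]
        simp
      have hentry : ∀ (e e' : Expr), ∀ i < n, ∀ j < n,
          e.eval (s.put 7 ((k + 1 : ℕ) : ℤ) 1 f) = (i : ℤ) →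
          e'.eval (s.put 7 ((k + 1 : ℕ) : ℤ) 1 f) = (j : ℤ) →
          (entryE e e').eval (s.put 7 ((k + 1 : ℕ) : ℤ) 1 f) = u (i * n + j) := by
        intro e e' i hi j hj he he'
        have hr : (Expr.var 1 + (e * .var 0 + e')).eval (s.put 7 ((k + 1 : ℕ) : ℤ) 1 f) =
            ((m + (i * n + j) : ℕ) : ℤ) := by
          rw [Expr.eval_add, Expr.eval_add, Expr.eval_mul, Expr.eval_var, Expr.eval_var, he, he',
            h0, h1]
          push_cast
          rfl
        have := hlt i hi j hj
        rw [entryE, Expr.eval_div, hF'.eval_cell h3 hr h2 (by omega) (by omega), Expr.eval_var, h4,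
          hu _ this]
      rw [Expr.eval_add, Expr.eval_mul, Expr.eval_mul, eval_ltE hI hJ, eval_ltE hJ hI,
        hentry _ _ _ hi _ hj hI hJ, hentry _ _ _ hj _ hi hJ hI]
      have hk1 : ((k + 1 : ℕ) : ℤ) ≠ 0 := by omega
      simp only [hk1, if_false, weight, Nat.add_sub_cancel, Nat.succ_ne_zero]
      split_ifs <;> omega
  · intro k hk
    split_ifs with h0
    · exact hf.index' (by omega)
    · obtain ⟨hn, hi, hj⟩ := hidx (k - 1) (by omega)
      unfold weight
      split_ifs
      · exact hub _ (hlt _ hi _ hj)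
      · exact hub _ (hlt _ hj _ hi)
      · simp [bits]
  · rintro _ ⟨-, f, rfl, hf⟩
    constructor
    · simpa using hf 0 (by omega)
    · intro k hk
      simpa using hf (k + 1) (by omega)

/-! #### Input -/

/-- The address of the `i`-th entry of the current sample. -/
def addressE (i : Expr) : Expr := .const 5 + rowE * (.var 0 + .const 1) + i

def loadE : Expr :=
  ltE rowE (.var 1) *
    (ltE colE (.var 2) * (ltE (colE / .var 0) (colE % .var 0) *
      (.read 0 (addressE (colE / .var 0)) * .read 0 (addressE (colE % .var 0)))) -
      eqE colE (.var 2) * .read 0 (addressE (.var 0))) +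
  (.const 1 - ltE rowE (.var 1)) * eqE (rowE - .var 1) colE

/-- The linear system of samples with indicator vectors `b` and values `v`. -/
def system (b : ℕ → ℕ → ℤ) (v : ℕ → ℤ) (n m ρ γ : ℕ) : ℤ :=
  if ρ < m then
    if γ < n * n then if γ / n < γ % n then b ρ (γ / n) * b ρ (γ % n) else 0
    else if γ = n * n then -v ρ else 0
  else if γ < n * n ∧ γ = ρ - m then 1 else 0

def load : Program :=
  .seq (.assign 0 (.read 0 (.const 1))) (.seq (.assign 1 (.read 0 (.const 4)))
    (.seq (.assign 2 (.var 0 * .var 0)) (.seq (.assign 3 (.var 2 + .const 2))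
      (.seq (upd 2 (.var 1 + .var 2) loadE) (.assign 4 (.const 1))))))

def loadTime (m d : ℕ) : ℕ :=
  ((Expr.read 0 (.const 1)).wt + 1) + (((Expr.read 0 (.const 4)).wt + 1) +
    (((.var 0 * .var 0 : Expr).wt + 1) + (((.var 2 + .const 2 : Expr).wt + 1) +
      (updTime (.var 1 + .var 2) loadE ((m + d) * (d + 2)) + ((Expr.const 1).wt + 1)))))

/-- Address 0 holds the length of the input, and the addresses 1 to 4 hold its four parameters, of
which the first and the fourth are used. The samples start at address 5 in blocks of n + 1 entries.
-/
theorem load_runs {b : ℕ → ℕ → ℤ} {v : ℕ → ℤ} (hf : Fits m (n * n) K L) (hs : s.Bounded L)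
    (hn : s.arr 0 1 = n) (hm : s.arr 0 4 = m) (hnL : bits (n : ℤ) ≤ L)
    (hb : ∀ ρ < m, ∀ i < n, s.arr 0 ((5 + ρ * (n + 1) + i : ℕ) : ℤ) = b ρ i)
    (hv : ∀ ρ < m, s.arr 0 ((5 + ρ * (n + 1) + n : ℕ) : ℤ) = v ρ)
    (hK : ∀ ρ γ, |system b v n m ρ γ| ≤ K) :
    Runs L load s (loadTime m (n * n)) fun s' => Env L n m s' ∧
      Holds s' 2 (m + n * n) (n * n + 2) (system b v n m) ∧ s'.var 4 = 1 := by
  refine Runs.seq (Runs.assign hs ?_)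
  have h0 : (Expr.read 0 (.const 1)).eval s = n := hn
  rw [h0]
  have hs0 := hs.setVar (x := 0) hnL
  refine Runs.seq (Runs.assign hs0 ?_)
  have h1 : (Expr.read 0 (.const 4)).eval (s.setVar 0 n) = m := hm
  rw [h1]
  have hs1 := hs0.setVar (x := 1) (hf.index' (k := m) (by omega))
  refine Runs.seq (Runs.assign hs1 ?_)
  have h2 : (.var 0 * .var 0 : Expr).eval ((s.setVar 0 n).setVar 1 m) = ((n * n : ℕ) : ℤ) := by
    simp
  rw [h2]
  have hs2 := hs1.setVar (x := 2) (hf.index' (k := n * n) (by omega))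
  refine Runs.seq (Runs.assign hs2 ?_)
  have h3 : (.var 2 + .const 2 : Expr).eval (((s.setVar 0 n).setVar 1 m).setVar 2
      ((n * n : ℕ) : ℤ)) = ((n * n + 2 : ℕ) : ℤ) := by simp
  rw [h3]
  have hs3 := hs2.setVar (x := 3) (hf.index' (k := n * n + 2) (by omega))
  set s₃ := (((s.setVar 0 n).setVar 1 m).setVar 2 ((n * n : ℕ) : ℤ)).setVar 3
    ((n * n + 2 : ℕ) : ℤ) with hs₃
  have henv : Env L n m s₃ := ⟨hs3, by simp [hs₃], by simp [hs₃], by simp [hs₃], by simp [hs₃]⟩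
  have harr : s₃.arr = s.arr := rfl
  refine Runs.seq ((upd_runs (system b v n m) (H := m + n * n) (by norm_num) hs3 henv.var_W
    ?_ ?_ ?_ ?_).imp ?_)
  · intro s' hv
    simp [hv, henv.var_m, henv.var_d]
  · intro ρ hρ γ hγ s' hv' ha hr hc
    have h0 : (Expr.var 0).eval s' = n := by rw [Expr.eval_var, hv' 0 (by norm_num), henv.var_n]
    have h1 : (Expr.var 1).eval s' = m := by rw [Expr.eval_var, hv' 1 (by norm_num), henv.var_m]
    have h2 : (Expr.var 2).eval s' = ((n * n : ℕ) : ℤ) := by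
      rw [Expr.eval_var, hv' 2 (by norm_num), henv.var_d]
    have hi : (colE / .var 0).eval s' = ((γ / n : ℕ) : ℤ) := by
      rw [Expr.eval_div, hc, h0]
      simp
    have hj : (colE % .var 0).eval s' = ((γ % n : ℕ) : ℤ) := by
      rw [Expr.eval_mod, hc, h0]
      simp
    have haddr : ∀ (e : Expr) (i : ℕ), e.eval s' = i →
        (Expr.read 0 (addressE e)).eval s' = s.arr 0 ((5 + ρ * (n + 1) + i : ℕ) : ℤ) := by
      intro e i he
      rw [Expr.eval_read, ha 0 (by norm_num), harr, addressE, Expr.eval_add, Expr.eval_add,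
        Expr.eval_mul, Expr.eval_add, he, hr, h0]
      simp
    rw [loadE, Expr.eval_add, Expr.eval_mul, Expr.eval_mul, Expr.eval_sub, Expr.eval_sub,
      Expr.eval_mul, Expr.eval_mul, Expr.eval_mul, Expr.eval_mul, eval_ltE hr h1, eval_ltE hc h2,
      eval_ltE hi hj, eval_eqE, eval_eqE, Expr.eval_sub, hr, hc, h1, h2, haddr _ _ hi, haddr _ _ hj,
      haddr _ _ h0, Expr.eval_const]
    unfold system
    by_cases h4 : ρ < m
    · rw [if_pos h4, if_pos h4, hv ρ h4]
      by_cases h5 : γ < n * n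
      · have hn0 : 0 < n := Nat.pos_of_ne_zero (by rintro rfl; simp at h5)
        rw [if_pos h5, if_pos h5, hb ρ h4 _ (Nat.div_lt_of_lt_mul h5),
          hb ρ h4 _ (Nat.mod_lt _ hn0), if_neg fun h => h5.ne (Nat.cast_inj.1 h)]
        split_ifs <;> simp
      · rw [if_neg h5, if_neg h5]
        simp only [Nat.cast_inj]
        split_ifs <;> simp
    · rw [if_neg h4, if_neg h4]
      -- The program omits the test γ < n * n, which follows from γ = ρ - m within the rows of the
      -- matrix.
      by_cases h5 : γ = ρ - m
      · have h6 : (ρ : ℤ) - m = γ := by omega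
        have h7 : ρ - m < n * n := by omega
        simpa [h6, h5] using h7
      · have h6 : (ρ : ℤ) - m ≠ γ := by omega
        simp [h6, h5]
  · exact hf.index _ (Nat.mul_le_mul_right _ (by omega))
  · intro ρ _ γ _
    exact hf.le (hK ρ γ)
  · rintro s₄ ⟨hb', hv', -, hH⟩
    refine Runs.assign hb' ⟨(henv.congr hb' hv').setVar (by norm_num) ?_, hH.setVar _ _, by simp⟩
    exact hf.le (by simpa using hf.one_le)

end Learner

namespace Learner

open RAM Finset

/-! #### The complete algorithm -/

/-- Array 0 is the input, 1 the output, 2 the eliminated matrix, 3 scratch space, 4 the matrix of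
the congruences. Variable 4 holds the last pivot D, variable 5 the modulus |D|. -/
def learner : Program :=
  .seq load (.seq elimination (.seq startCongruences (.seq congruences (.seq accumulate output))))

def learnerTime (m d L : ℕ) : ℕ :=
  loadTime m d + (forTime (.var 1) m (elimBodyTime m d) + (startTime d +
    (forTime (.var 2) d (congruenceBodyTime d L) +
      (forTime (.var 2) d (updTime (.var 1 + .var 2) accE ((m + d) * (d + 2))) +
        fillTime (.var 2 + .const 1) outputE (d + 1)))))

variable {L n m : ℕ} {s : State}

theorem learner_runs {b : ℕ → ℕ → ℤ} {v w : ℕ → ℤ} {V : ℤ} (hV : 1 ≤ V)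
    (hf : Fits m (n * n) ((m + 1).factorial * V ^ (m + 1)) L) (hs : s.Bounded L)
    (hn : s.arr 0 1 = n) (hm : s.arr 0 4 = m) (hnL : bits (n : ℤ) ≤ L)
    (hb : ∀ ρ < m, ∀ i < n, s.arr 0 ((5 + ρ * (n + 1) + i : ℕ) : ℤ) = b ρ i)
    (hv : ∀ ρ < m, s.arr 0 ((5 + ρ * (n + 1) + n : ℕ) : ℤ) = v ρ)
    (hX : ∀ ρ γ, |system b v n m ρ γ| ≤ V)
    (hsys : Elimination.IsSystem (system b v n m) m (n * n) w) :
    Runs L learner s (learnerTime m (n * n) L) fun s' => ∃ u : ℕ → ℤ,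
      (∀ ρ < m, system b v n m ρ (n * n) +
        ∑ i ∈ range (n * n), system b v n m ρ i * u i = 0) ∧
      s'.arr 1 0 = (n * n : ℕ) ∧
      ∀ k < n * n, s'.arr 1 ((k : ℤ) + 1) = weight u n (k / n) (k % n) := by
  set X := system b v n m with hXdef
  set K : ℤ := (m + 1).factorial * V ^ (m + 1) with hKdef
  have hK : ∀ k F D, k ≤ m → Elimination.Invariant X m (n * n) w k F D →
      |D| ≤ K ∧ ∀ ρ γ, |F ρ γ| ≤ K := fun k F D hk hI => hI.bordered.bounds hk hV hX
  refine Runs.seq ((load_runs hf hs hn hm hnL hb hv (hK 0 X 1 (by omega) hsys.invariant).2).imp ?_)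
  rintro s₁ ⟨h1, hF1, hD1⟩
  refine Runs.seq ((elimination_runs hf hsys hK ⟨h1, X, hF1, hD1 ▸ hsys.invariant⟩).imp ?_)
  rintro s₂ ⟨h2, F, hF2, hI⟩
  obtain ⟨hDK, hFK⟩ := hK _ _ _ le_rfl hI
  set D := s₂.var 4 with hD
  have hD0 : D ≠ 0 := hI.bordered.1
  have hE0 : 0 < |D| := abs_pos.2 hD0
  refine Runs.seq ((startCongruences_runs hf h2 hF2 hD0 hDK).imp ?_)
  intro s₃ h3
  -- The hidden solution `w` witnesses that the congruences are solvable.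
  have hG : Congruence.Outer (fun ρ => F (m + ρ)) (fun ρ => F (m + ρ) (n * n)) (n * n) |D| 0
      (Congruence.start (fun ρ => F (m + ρ)) (n * n) |D|) :=
    Congruence.outer_start hE0 (w := w) fun ρ hρ => by
      rw [hI.solution_eq hsys ρ hρ, abs_dvd]
      exact dvd_mul_right _ _
  refine Runs.seq ((congruences_runs hf hE0 hDK h3 hG).imp ?_)
  rintro s₄ ⟨G, h4, hG4⟩
  have hGK : ∀ ρ γ, |G ρ γ| ≤ K := fun ρ γ => by
    rw [abs_of_nonneg (hG4.nonneg ρ γ)]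
    exact (hG4.le ρ γ).trans hDK
  refine Runs.seq ((accumulate_runs hf h4 hFK hGK).imp ?_)
  intro s₅ h5
  let u : ℕ → ℤ := fun k =>
    acc F (fun j => G (n * n + j) (n * n)) (n * n) (n * n) (m + k) (n * n) / D
  refine (output_runs hf h5 (u := u) (abs_acc_le le_rfl hFK fun j => hGK _ _)
    fun k _ => rfl).imp ?_
  rintro s₆ h6
  refine ⟨u, hI.isSolution (t := fun j => G (n * n + j) (n * n)) fun i hi => ?_, h6⟩
  have := hG4.dvd i hi
  rw [abs_dvd] at this
  simpa [u, acc] using Int.mul_ediv_cancel' this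

/-! #### Bounds -/

/-- A bound for the bit length of the integers that occur on inputs of size `x`. -/
def bitBound (x : ℕ) : ℕ :=
  2 * ((x + 1) * (x + 1) + x * (x + 1)) + x * x + 1 + (x + 2 * (x * x) + 1) * (x * x + 2) + x

theorem factorial_mul_pow_le {x : ℕ} (hm : m ≤ x) :
    (m + 1).factorial * (2 ^ x) ^ (m + 1) ≤ 2 ^ ((x + 1) * (x + 1) + x * (x + 1)) := by
  calc (m + 1).factorial * (2 ^ x) ^ (m + 1) ≤ (m + 1) ^ (m + 1) * (2 ^ x) ^ (m + 1) := by
        gcongr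
        exact Nat.factorial_le_pow _
    _ ≤ (2 ^ (m + 1)) ^ (m + 1) * (2 ^ x) ^ (m + 1) := by
        gcongr
        exact Nat.lt_two_pow_self.le
    _ = 2 ^ ((m + 1) * (m + 1) + x * (m + 1)) := by rw [← pow_mul, ← pow_mul, ← pow_add]
    _ ≤ _ := by gcongr; norm_num

/-- With K ≤ 2^κ, the largest stored integers are at most (n² + 1) K² ≤ 2^(n² + 2κ); the product in
`bitBound` accounts for the indices of matrix entries. -/
theorem fits_bitBound {x : ℕ} (hm : m ≤ x) (hn : n ≤ x) :
    Fits m (n * n) ((m + 1).factorial * (2 ^ x) ^ (m + 1)) (bitBound x) := by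
  have hnn : n * n ≤ x * x := Nat.mul_le_mul hn hn
  set κ := (x + 1) * (x + 1) + x * (x + 1) with hκ
  have hK := factorial_mul_pow_le hm
  have hK1 : 1 ≤ (m + 1).factorial * (2 ^ x) ^ (m + 1) := Nat.succ_le_of_lt (by positivity)
  have ecast : (((m + 1).factorial * (2 ^ x) ^ (m + 1) : ℤ)) =
      (((m + 1).factorial * (2 ^ x) ^ (m + 1) : ℕ) : ℤ) := by push_cast; rfl
  rw [ecast]
  set K := (m + 1).factorial * (2 ^ x) ^ (m + 1)
  refine ⟨by exact_mod_cast hK1, fun z hz => ?_, fun k hk => ?_⟩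
  · rw [bits_le_iff]
    have hz' : z.natAbs ≤ K + n * n * K * K := by
      rw [Int.abs_eq_natAbs] at hz
      exact_mod_cast hz
    calc z.natAbs ≤ K + n * n * K * K := hz'
      _ ≤ (n * n + 1) * (K * K) := by nlinarith
      _ ≤ 2 ^ (n * n) * (2 ^ κ * 2 ^ κ) := by
          gcongr
          exact Nat.lt_two_pow_self
      _ = 2 ^ (n * n + (κ + κ)) := by rw [pow_add 2 (n * n), pow_add 2 κ κ]
      _ < 2 ^ bitBound x := by
          apply Nat.pow_lt_pow_right (by norm_num)
          unfold bitBound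
          rw [← hκ]
          omega
  · rw [bits_le_iff, Int.natAbs_natCast]
    refine lt_of_le_of_lt ?_ (Nat.lt_two_pow_self (n := bitBound x))
    have : (m + 2 * (n * n) + 1) * (n * n + 2) ≤ (x + 2 * (x * x) + 1) * (x * x + 2) := by gcongr
    unfold bitBound
    omega

theorem learnerTime_mono {m m' d d' L L' : ℕ} (hm : m ≤ m') (hd : d ≤ d') (hL : L ≤ L') :
    learnerTime m d L ≤ learnerTime m' d' L' := by
  simp only [learnerTime, loadTime, elimBodyTime, searchTime, startTime, congruenceBodyTime,
    euclidTime, euclidBodyTime, updTime, fillTime, forTime]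
  gcongr

/-- Functions given by polynomials with coefficients in `ℕ`. -/
def IsPoly (f : ℕ → ℕ) : Prop := ∃ p : Polynomial ℕ, ∀ x, f x = p.eval x

theorem IsPoly.const (c : ℕ) : IsPoly fun _ => c := ⟨.C c, fun x => by simp⟩

theorem IsPoly.id : IsPoly fun x => x := ⟨.X, fun x => by simp⟩

theorem IsPoly.add {f g : ℕ → ℕ} (hf : IsPoly f) (hg : IsPoly g) : IsPoly fun x => f x + g x := by
  obtain ⟨p, hp⟩ := hf
  obtain ⟨q, hq⟩ := hg
  exact ⟨p + q, fun x => by simp [hp, hq]⟩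

theorem IsPoly.mul {f g : ℕ → ℕ} (hf : IsPoly f) (hg : IsPoly g) : IsPoly fun x => f x * g x := by
  obtain ⟨p, hp⟩ := hf
  obtain ⟨q, hq⟩ := hg
  exact ⟨p * q, fun x => by simp [hp, hq]⟩

theorem IsPoly.forTime (e : Expr) {f g : ℕ → ℕ} (hf : IsPoly f) (hg : IsPoly g) :
    IsPoly fun x => forTime e (f x) (g x) :=
  .add (.const _) (.mul (.add hf (.const _)) (.add (.add (.add hg (.const _)) (.const _)) (.const _)))

theorem IsPoly.fillTime (e e' : Expr) {f : ℕ → ℕ} (hf : IsPoly f) :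
    IsPoly fun x => fillTime e e' (f x) := .forTime _ hf (.const _)

theorem IsPoly.updTime (e e' : Expr) {f : ℕ → ℕ} (hf : IsPoly f) :
    IsPoly fun x => updTime e e' (f x) := .add (.fillTime _ _ hf) (.fillTime _ _ hf)

theorem isPoly_bitBound : IsPoly bitBound := by
  unfold bitBound
  repeat' first
    | exact IsPoly.const _
    | exact IsPoly.id
    | apply IsPoly.add
    | apply IsPoly.mul

theorem isPoly_learnerTime :
    IsPoly fun x => learnerTime x (x * x) (bitBound x) * (bitBound x + 1) := by
  simp only [learnerTime, loadTime, elimBodyTime, searchTime, startTime, congruenceBodyTime,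
    euclidTime, euclidBodyTime]
  repeat' first
    | with_reducible exact IsPoly.const _
    | with_reducible exact IsPoly.id
    | with_reducible exact isPoly_bitBound
    | with_reducible apply IsPoly.forTime
    | with_reducible apply IsPoly.updTime
    | with_reducible apply IsPoly.fillTime
    | with_reducible apply IsPoly.add
    | with_reducible apply IsPoly.mul

end Learner

namespace Learner

open RAM Finset

/-! #### Correctness -/

theorem getD_flatMap {α : Type} (f : α → List ℤ) {B : ℕ} (hf : ∀ a, (f a).length = B)
    (l : List α) (ρ : ℕ) (hρ : ρ < l.length) (i : ℕ) (hi : i < B) :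
    (l.flatMap f).getD (ρ * B + i) 0 = (f l[ρ]).getD i 0 := by
  induction l generalizing ρ with
  | nil => simp at hρ
  | cons a l ih =>
    rw [List.flatMap_cons]
    cases ρ with
    | zero =>
      rw [List.getD_append _ _ _ _ (by rw [hf]; omega)]
      simp
    | succ ρ =>
      rw [List.getD_append_right _ _ _ _ (by rw [hf]; nlinarith), hf,
        show (ρ + 1) * B + i - B = ρ * B + i by rw [add_mul, one_mul]; omega]
      exact ih ρ (by simpa using hρ)

theorem init_arr (l : List ℤ) (k : ℕ) :
    (State.init l).arr 0 ((k + 1 : ℕ) : ℤ) = l.getD k 0 := by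
  simp only [State.init, if_true]
  rw [if_neg (by omega), if_pos (by omega)]
  congr 1
  omega

theorem bits_le_inputSize (l : List ℤ) (k : ℕ) : bits (l.getD k 0) ≤ inputSize l := by
  rcases lt_or_ge k l.length with h | h
  · rw [List.getD_eq_getElem _ _ h]
    have : 1 + bits l[k] ∈ l.map fun z => 1 + bits z :=
      List.mem_map.2 ⟨_, List.getElem_mem h, rfl⟩
    have := List.single_le_sum (fun _ _ => Nat.zero_le _) _ this
    unfold inputSize
    omega
  · rw [List.getD_eq_default _ _ h]
    simp [bits]

theorem length_le_inputSize (l : List ℤ) : l.length ≤ inputSize l := by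
  unfold inputSize
  induction l with
  | nil => simp
  | cons a l ih => simp only [List.length_cons, List.map_cons, List.sum_cons]; omega

theorem init_bounded (l : List ℤ) : (State.init l).Bounded (inputSize l) := by
  refine ⟨fun y => by simp [State.init, bits], fun a i => ?_⟩
  simp only [State.init]
  split_ifs
  · rw [bits_le_iff, Int.natAbs_natCast]
    exact (length_le_inputSize l).trans_lt Nat.lt_two_pow_self
  · exact bits_le_inputSize l _
  · simp [bits]
  · simp [bits]

section Input

variable {n : ℕ} (v : Finset (Fin n) → ℤ) (ε δ : ℝ) {m : ℕ} (x : Fin m → Finset (Fin n))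

theorem length_encodeSample (S : Finset (Fin n)) : (PAC.encodeSample v S).length = n + 1 := by
  simp [PAC.encodeSample]

theorem length_learnerInput : (PAC.learnerInput v ε δ x).length = 4 + m * (n + 1) := by
  simp [PAC.learnerInput, List.length_flatMap, length_encodeSample, Function.comp_def]
  omega

theorem learnerInput_getD {ρ i : ℕ} (hρ : ρ < m) (hi : i < n + 1) :
    (PAC.learnerInput v ε δ x).getD (4 + ρ * (n + 1) + i) 0 =
      (PAC.encodeSample v (x ⟨ρ, hρ⟩)).getD i 0 := by
  rw [PAC.learnerInput, List.getD_append_right _ _ _ _ (by simp; omega)]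
  have := getD_flatMap (PAC.encodeSample v) (length_encodeSample v) (List.ofFn x) ρ
    (by simpa using hρ) i hi
  rw [List.getElem_ofFn] at this
  rw [← this]
  congr 1
  simp
  omega

theorem learnerInput_getD_mem {ρ : ℕ} (hρ : ρ < m) (i : Fin n) :
    (PAC.learnerInput v ε δ x).getD (4 + ρ * (n + 1) + i) 0 =
      if i ∈ x ⟨ρ, hρ⟩ then 1 else 0 := by
  rw [learnerInput_getD v ε δ x hρ (by omega), PAC.encodeSample,
    List.getD_append _ _ _ _ (by simp), List.getD_eq_getElem _ _ (by simp)]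
  simp

theorem learnerInput_getD_value {ρ : ℕ} (hρ : ρ < m) :
    (PAC.learnerInput v ε δ x).getD (4 + ρ * (n + 1) + n) 0 = v (x ⟨ρ, hρ⟩) := by
  rw [learnerInput_getD v ε δ x hρ (by omega), PAC.encodeSample,
    List.getD_append_right _ _ _ _ (by simp)]
  simp

end Input

theorem inducedValue_eq_sum_ite {n : ℕ} (G : WeightedGraph n) (S : Finset (Fin n)) :
    G.inducedValue S = ∑ i, ∑ j, if i ∈ S ∧ j ∈ S ∧ i < j then G.1 i j else 0 := by
  have h : ∀ g : Fin n → ℤ, ∑ i ∈ S, g i = ∑ i, if i ∈ S then g i else 0 := fun g => by simp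
  rw [WeightedGraph.inducedValue, h]
  refine sum_congr rfl fun i _ => ?_
  rw [sum_filter, h]
  by_cases hi : i ∈ S
  · simp [hi, ite_and]
  · simp [hi]

theorem mul_add_div {n : ℕ} (i j : Fin n) : ((i : ℕ) * n + j) / n = i := by
  rw [mul_comm, Nat.mul_add_div i.pos, Nat.div_eq_of_lt j.2, add_zero]

theorem mul_add_mod {n : ℕ} (i j : Fin n) : ((i : ℕ) * n + j) % n = j := by
  rw [mul_comm, Nat.mul_add_mod, Nat.mod_eq_of_lt j.2]

theorem inducedValue_eq_sum {n : ℕ} (G : WeightedGraph n) (S : Finset (Fin n)) {u b : ℕ → ℤ}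
    (hu : ∀ i j : Fin n, i < j → G.1 i j = u (i * n + j))
    (hb : ∀ i : Fin n, b i = if i ∈ S then 1 else 0) :
    G.inducedValue S = ∑ γ ∈ range (n * n),
      (if γ / n < γ % n then b (γ / n) * b (γ % n) else 0) * u γ := by
  rw [sum_range, ← (finProdFinEquiv (m := n) (n := n)).sum_comp, Fintype.sum_prod_type,
    inducedValue_eq_sum_ite]
  refine sum_congr rfl fun i _ => sum_congr rfl fun j _ => ?_
  have e : (finProdFinEquiv (i, j) : ℕ) = i * n + j := by
    simp [finProdFinEquiv]
    ring
  rw [e, mul_add_div, mul_add_mod, hb, hb]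
  by_cases h : i < j
  · rw [if_pos (Fin.lt_def.1 h), ← hu i j h]
    by_cases hi : i ∈ S <;> by_cases hj : j ∈ S <;> simp [h, hi, hj]
  · rw [if_neg fun h' => h (Fin.lt_def.2 h')]
    simp [h]

theorem weight_comm (u : ℕ → ℤ) (n i j : ℕ) : weight u n i j = weight u n j i := by
  unfold weight
  split_ifs <;> first | rfl | omega

/-- The weighted graph with weights `u (i * n + j)` for `i < j`. -/
def graph (u : ℕ → ℤ) (n : ℕ) : WeightedGraph n :=
  ⟨Matrix.of fun i j => weight u n i j, by
    constructor
    · ext i j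
      exact weight_comm u n j i
    · intro i
      simp [weight]⟩

/-- A single run provides the output, the time bound and consistency together. -/
theorem exists_polynomial : ∃ p : Polynomial ℕ, ∀ (n : ℕ) (f : WeightedGraph n) (ε δ : ℝ) (m : ℕ)
    (x : Fin m → Finset (Fin n)), ∃ (h : WeightedGraph n) (t : ℕ),
    learner.Computes (PAC.learnerInput f.inducedValue ε δ x) h.toList t ∧
    t ≤ p.eval (n + ⌈1 / ε⌉₊ + ⌈1 / δ⌉₊ + inputSize (PAC.learnerInput f.inducedValue ε δ x)) ∧
    ∀ j, h.inducedValue (x j) = f.inducedValue (x j) := by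
  obtain ⟨p, hp⟩ := isPoly_learnerTime
  refine ⟨p, fun n f ε δ m x => ?_⟩
  set l := PAC.learnerInput f.inducedValue ε δ x with hl
  set X := n + ⌈1 / ε⌉₊ + ⌈1 / δ⌉₊ + inputSize l with hX
  have hlX : inputSize l ≤ X := by omega
  have hnX : n ≤ X := by omega
  have hmX : m ≤ X := by
    have h1 := length_le_inputSize l
    rw [hl, length_learnerInput, ← hl] at h1
    nlinarith
  have hXL : X ≤ bitBound X := by unfold bitBound; omega
  let b : ℕ → ℕ → ℤ := fun ρ i => l.getD (4 + ρ * (n + 1) + i) 0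
  let v : ℕ → ℤ := fun ρ => l.getD (4 + ρ * (n + 1) + n) 0
  let w : ℕ → ℤ := fun γ => if h : γ / n < n ∧ γ % n < n then f.1 ⟨γ / n, h.1⟩ ⟨γ % n, h.2⟩ else 0
  have hb : ∀ ρ (hρ : ρ < m) (i : Fin n), b ρ i = if i ∈ x ⟨ρ, hρ⟩ then 1 else 0 :=
    fun ρ hρ i => learnerInput_getD_mem _ ε δ x hρ i
  have hv : ∀ ρ (hρ : ρ < m), v ρ = f.inducedValue (x ⟨ρ, hρ⟩) :=
    fun ρ hρ => learnerInput_getD_value _ ε δ x hρ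
  have hw : ∀ i j : Fin n, i < j → f.1 i j = w (i * n + j) := by
    intro i j _
    simp [w, mul_add_div, Nat.mod_eq_of_lt j.2]
  -- This is used twice: for the hidden graph it shows that the system is solvable, and for the
  -- computed graph it turns a solution into consistency.
  have hsum : ∀ ρ (hρ : ρ < m) (G : WeightedGraph n) (u : ℕ → ℤ),
      (∀ i j : Fin n, i < j → G.1 i j = u (i * n + j)) →
      system b v n m ρ (n * n) + ∑ γ ∈ range (n * n), system b v n m ρ γ * u γ =
        G.inducedValue (x ⟨ρ, hρ⟩) - f.inducedValue (x ⟨ρ, hρ⟩) := by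
    intro ρ hρ G u hu
    rw [inducedValue_eq_sum G _ hu (hb ρ hρ), ← hv ρ hρ,
      sum_congr rfl fun γ hγ => by rw [system, if_pos hρ, if_pos (mem_range.1 hγ)]]
    simp [system, hρ]
    ring
  -- The labels are part of the input, so they have at most `X` bits; the other entries are 0 or 1.
  have hV : (1 : ℤ) ≤ 2 ^ X := one_le_pow₀ (by norm_num)
  have hsysV : ∀ ρ γ, |system b v n m ρ γ| ≤ 2 ^ X := by
    intro ρ γ
    have hb' : ∀ ρ < m, ∀ i < n, b ρ i = 0 ∨ b ρ i = 1 := by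
      intro ρ hρ i hi
      rw [hb ρ hρ ⟨i, hi⟩]
      split_ifs <;> simp
    unfold system
    split_ifs with h1 h2 h3
    · have hn0 : 0 < n := Nat.pos_of_ne_zero (by rintro rfl; simp at h2)
      rcases hb' ρ h1 _ (Nat.div_lt_of_lt_mul h2) with h | h <;>
      rcases hb' ρ h1 _ (Nat.mod_lt γ hn0) with h' | h' <;> simp [h, h', hV]
    · simp
    · have h4 : bits (v ρ) ≤ X := (bits_le_inputSize l _).trans hlX
      rw [bits_le_iff] at h4
      rw [abs_neg, Int.abs_eq_natAbs]
      exact_mod_cast h4.le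
    · simp
    · simpa using hV
    · simp
  have hsys : Elimination.IsSystem (system b v n m) m (n * n) w := by
    refine ⟨fun i hi γ => ?_, fun ρ => ?_, fun ρ hρ => ?_⟩
    · unfold system
      rw [if_neg (by omega), Nat.add_sub_cancel_left]
      refine if_congr ⟨fun h => h.2, fun h => ⟨by omega, h⟩⟩ rfl rfl
    · simp [system]
    · rw [hsum ρ hρ f w hw, sub_self]
  have hs : (State.init l).Bounded (bitBound X) :=
    ⟨fun y => ((init_bounded l).1 y).trans (hlX.trans hXL),
      fun a i => ((init_bounded l).2 a i).trans (hlX.trans hXL)⟩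
  have hnL : bits (n : ℤ) ≤ bitBound X := by
    rw [bits_le_iff, Int.natAbs_natCast]
    exact (hnX.trans hXL).trans_lt Nat.lt_two_pow_self
  obtain ⟨t, s', hexec, ht, u, hu, hout⟩ := learner_runs hV
    (fits_bitBound hmX hnX) hs (init_arr l 0) (init_arr l 3) hnL
    (fun ρ _ i _ => (congrArg _ (by push_cast; ring)).trans (init_arr l (4 + ρ * (n + 1) + i)))
    (fun ρ _ => (congrArg _ (by push_cast; ring)).trans (init_arr l (4 + ρ * (n + 1) + n)))
    hsysV hsys
  refine ⟨graph u n, t, ⟨s', hexec, ?_, ?_⟩, ?_, ?_⟩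
  · simpa [WeightedGraph.toList] using hout.1
  · intro k
    have hk : (k : ℕ) < n * n := by simpa [WeightedGraph.toList] using k.2
    rw [hout.2 k hk]
    rw [List.get_eq_getElem]
    simp [WeightedGraph.toList, graph]
  · rw [← hp]
    exact ht.trans (Nat.mul_le_mul_right _
      (learnerTime_mono hmX (Nat.mul_le_mul hnX hnX) le_rfl))
  · intro j
    have := hu j j.2
    rw [hsum j j.2 (graph u n) u fun i j hij => by simp [graph, weight, hij]] at this
    exact sub_eq_zero.1 this

theorem isConsistentLearner : PAC.IsConsistentLearner inducedSubgraphGames learner := by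
  obtain ⟨p, hp⟩ := exists_polynomial
  intro n f ε δ _ _ m x
  obtain ⟨h, t, h1, -, h2⟩ := hp n f ε δ m x
  exact ⟨h, t, h1, h2⟩

theorem runsInPolyTime : PAC.RunsInPolyTime inducedSubgraphGames learner := by
  obtain ⟨p, hp⟩ := exists_polynomial
  refine ⟨p, fun n f ε δ _ _ m x => ?_⟩
  obtain ⟨h, t, h1, h2, -⟩ := hp n f ε δ m x
  exact ⟨h, t, h1, h2⟩

/-- Coalitions are mapped to indicator vectors of their pairs i < j in dimension n²; the difference
of two games is the functional given by the difference of the weights. -/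
theorem exists_pacLearns : ∃ m₀ : ℕ → ℝ → ℝ → ℕ, PAC.PolynomiallyBounded m₀ ∧
    PAC.PACLearns inducedSubgraphGames learner m₀ := by
  refine PAC.exists_pacLearns isConsistentLearner (fun n => Fin n × Fin n → ℚ) (fun n => ?_)
    (fun n S p => if p.1 ∈ S ∧ p.2 ∈ S ∧ p.1 < p.2 then 1 else 0) fun n f h => ?_
  · simp [sq]
  · refine ⟨∑ p, ((f.1 p.1 p.2 - h.1 p.1 p.2 : ℤ) : ℚ) • LinearMap.proj p, fun S => ?_⟩
    have key : ∀ G : WeightedGraph n, (G.inducedValue S : ℚ) = ∑ p : Fin n × Fin n,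
        (G.1 p.1 p.2 : ℚ) * if p.1 ∈ S ∧ p.2 ∈ S ∧ p.1 < p.2 then 1 else 0 := by
      intro G
      rw [inducedValue_eq_sum_ite, Fintype.sum_prod_type]
      push_cast
      simp
    have key' : (f.inducedValue S : ℚ) - h.inducedValue S = ∑ p : Fin n × Fin n,
        ((f.1 p.1 p.2 - h.1 p.1 p.2 : ℤ) : ℚ) *
          if p.1 ∈ S ∧ p.2 ∈ S ∧ p.1 < p.2 then 1 else 0 := by
      rw [key f, key h, ← sum_sub_distrib]
      push_cast
      simp only [sub_mul]
    refine Eq.trans ?_ key'.symm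
    simp [LinearMap.sum_apply]

end Learner

/-- The class of induced subgraph games is efficiently PAC learnable, by an algorithm that always
outputs a hypothesis consistent with the samples. -/
theorem mainTheorem6 :
    ∃ L : RAM.Program, PAC.IsEfficientPACLearner inducedSubgraphGames L ∧
      PAC.IsConsistentLearner inducedSubgraphGames L :=
  ⟨Learner.learner, ⟨Learner.runsInPolyTime, Learner.exists_pacLearns⟩, Learner.isConsistentLearner⟩
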